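/- Let $N,d\ge 1$ be integers, $\beta>0$, and let $\mathbb M_d$ (resp. $\mathfrak M_d$) be the space of real (resp. invertible real) $d\times d$ matrices; write $\sigma_1(X)\ge\cdots\ge\sigma_d(X)$ for the singular values of $X$. Equip $\mathfrak M_d$ with the metric $$g^N_X(Z,W)=\operatorname{Tr}\big(Z^T\mathcal A_{N,X}^{-1}W\big),\qquad \mathcal A_{N,X}(P)=\sum_{p=1}^N (XX^T)^{\frac{N-p}{N}}\,P\,(X^TX)^{\frac{p-1}{N}} .$$ Let $E(X)=g\big(\sum_i f(\sigma_i(X))\big)$ on $\mathfrak M_d$ with $g:\mathbb R\to\mathbb R$ nondecreasing, $f:(0,\infty)\to\mathbb R$ convex, and $f,g$ of class $C^2$. For $\sigma\in(0,\infty)^d$ put $E(\sigma)=g(\sum_i f(\sigma_i))$ and $$S_N(\sigma)=(N-1)c_d+\tfrac12\sum_{i<j}\log\frac{\sigma_i^2-\sigma_j^2}{\sigma_i^{2/N}-\sigma_j^{2/N}},$$ where $c_d$ is a real constant depending only on $d$ (its value, the volume of $O_d$, plays no role) and where the quotient is replaced by its limit $N\sigma_i^{2-2/N}$ if $\sigma_i=\sigma_j$;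 let $S_N(X)=S_N(\sigma_1(X),\dots,\sigma_d(X))$ and $F_\beta=E-\beta^{-1}S_N$. Let $\sigma_\star>0$ satisfy $$g'\big(d f(\sigma_\star)\big)f'(\sigma_\star)=\beta^{-1}\frac{d-1}{2\sigma_\star}\Big(1-\frac1N\Big),$$ and let $Q\in O_d$, $X_\star=\sigma_\star Q$ and $\mathcal O_\star=\{\sigma_\star R:R\in O_d\}$. Then the Euclidean Hessians of $E(\sigma)$ and $S_N(\sigma)$ at $\vec\sigma_\star=(\sigma_\star,\dots,\sigma_\star)$ act as scalars $\theta_{\mathbf 1}(E),\theta_{\mathbf 1}(S_N)$ on $\operatorname{span}\{\mathbf 1\}$ and $\theta_\perp(E),\theta_\perp(S_N)$ on $\operatorname{span}\{\mathbf 1\}^\perp$; set $$\rho_{\mathbf 1}=-N\sigma_\star^{2-2/N}\big(\theta_{\mathbf 1}(E)-\beta^{-1}\theta_{\mathbf 1}(S_N)\big),\qquad \rho_\perp=-N\sigma_\star^{2-2/N}\big(\theta_\perp(E)-\beta^{-1}\theta_\perp(S_N)\big).$$ The vector field of the gradient flow $\dot X=-\operatorname{grad}_{g^N}F_\beta(X)$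 is defined near $X_\star$, vanishes at $X_\star$ and is differentiable there, and its linearization at $X_\star$ diagonalizes in the splitting $$\mathbb M_d=T_{X_\star}\mathcal O_\star\oplus\operatorname{span}\{X_\star\}\oplus\{QS:S^T=S,\ \operatorname{tr}S=0\},\qquad T_{X_\star}\mathcal O_\star=\{X_\star A:A^T=-A\},$$ acting as $0$ on $T_{X_\star}\mathcal O_\star$, as $\rho_{\mathbf 1}$ on $\operatorname{span}\{X_\star\}$ and as $\rho_\perp$ on $\{QS:S^T=S,\ \operatorname{tr}S=0\}$. -/

import Mathlib

open Matrix Set Filter Topology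

namespace DLN

/-- The `i`-th singular value `σ_i(X)` of a square real matrix, in decreasing order. -/
noncomputable def sv {d : ℕ} (X : Matrix (Fin d) (Fin d) ℝ) (i : Fin d) : ℝ :=
  (Matrix.toEuclideanLin X).singularValues (i : ℕ)

/-- `E` is the spectral energy `E(X) = g (∑ i, f (σ_i(X)))` on invertible matrices, with `g`
nondecreasing and `f` convex on `(0, ∞)`. Only the values of `f` on `(0, ∞)` are used. -/
structure IsSpectralEnergy {d : ℕ} (E : Matrix (Fin d) (Fin d) ℝ → ℝ) (f g : ℝ → ℝ) : Prop where
  mono : Monotone g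
  convex : ConvexOn ℝ (Ioi 0) f
  eq : ∀ X : Matrix (Fin d) (Fin d) ℝ, IsUnit X → E X = g (∑ i, f (sv X i))

/-- The energy `E(σ) = g (∑ i, f (σ_i))` as a function of `σ ∈ (0, ∞)^d`. -/
noncomputable def energyOf {d : ℕ} (f g : ℝ → ℝ) (s : Fin d → ℝ) : ℝ :=
  g (∑ i, f (s i))

/-- The ratio `(a² - b²) / (a^{2/N} - b^{2/N})` for `a, b > 0`, extended continuously
(in fact analytically) to `a = b` by its limit `N a^{2 - 2/N}`. -/
noncomputable def ratio (N : ℕ) (a b : ℝ) : ℝ :=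
  if a = b then (N : ℝ) * a ^ (2 - 2 / (N : ℝ))
  else (a ^ 2 - b ^ 2) / (a ^ (2 / (N : ℝ)) - b ^ (2 / (N : ℝ)))

/-- The entropy `S_N(σ)` on `(0, ∞)^d`, where `c` stands for the additive constant `c_d`. -/
noncomputable def entropyOf (N : ℕ) (c : ℝ) {d : ℕ} (s : Fin d → ℝ) : ℝ :=
  ((N : ℝ) - 1) * c
    + 1 / 2 * ∑ i : Fin d, ∑ j ∈ Finset.univ.filter (fun j => i < j), Real.log (ratio N (s i) (s j))

/-- The entropy `S_N(X)` of a matrix. -/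
noncomputable def entropy (N : ℕ) (c : ℝ) {d : ℕ} (X : Matrix (Fin d) (Fin d) ℝ) : ℝ :=
  entropyOf N c (sv X)

/-- The free energy `F_β = E - β⁻¹ S_N` on matrices. -/
noncomputable def freeEnergy (N : ℕ) (c β : ℝ) {d : ℕ} (E : Matrix (Fin d) (Fin d) ℝ → ℝ)
    (X : Matrix (Fin d) (Fin d) ℝ) : ℝ :=
  E X - β⁻¹ * entropy N c X

/-- The operator `P ↦ ∑_{p=1}^N (X Xᵀ)^{(N-p)/N} P (Xᵀ X)^{(p-1)/N}`; the real powers of the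
positive semidefinite matrices are taken by functional calculus. -/
noncomputable def opA (N : ℕ) {d : ℕ} (X : Matrix (Fin d) (Fin d) ℝ) :
    Module.End ℝ (Matrix (Fin d) (Fin d) ℝ) :=
  ∑ p ∈ Finset.Icc 1 N, LinearMap.mulLeftRight ℝ
    (cfc (fun t : ℝ => t ^ (((N : ℝ) - (p : ℝ)) / (N : ℝ))) (X * Xᵀ),
     cfc (fun t : ℝ => t ^ (((p : ℝ) - 1) / (N : ℝ))) (Xᵀ * X))

/-- The metric `g^N` at `X`: `g^N_X(Z, W) = Tr (Zᵀ 𝒜_{N,X}⁻¹ W)`. The operator is invertible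
at every invertible `X`. -/
noncomputable def metric (N : ℕ) {d : ℕ} (X Z W : Matrix (Fin d) (Fin d) ℝ) : ℝ :=
  Matrix.trace (Zᵀ * Ring.inverse (opA N X) W)

/-- `Z` is the Riemannian gradient of `F` at `X`: `F` is differentiable at `X` and
`g^N_X(Z, W) = dF(X)[W]` for all `W`. -/
def IsGradAt (N : ℕ) {d : ℕ} (F : Matrix (Fin d) (Fin d) ℝ → ℝ)
    (X Z : Matrix (Fin d) (Fin d) ℝ) : Prop :=
  DifferentiableAt ℝ F X ∧ ∀ W, metric N X Z W = fderiv ℝ F X W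

/-- The Riemannian gradient `grad_{g^N} F (X)`. -/
noncomputable def grad (N : ℕ) {d : ℕ} (F : Matrix (Fin d) (Fin d) ℝ → ℝ)
    (X : Matrix (Fin d) (Fin d) ℝ) : Matrix (Fin d) (Fin d) ℝ :=
  Classical.epsilon (IsGradAt N F X)

/-- The Euclidean Hessian matrix `(∂²φ / ∂σ_i ∂σ_j)(s)`. -/
noncomputable def hess {d : ℕ} (φ : (Fin d → ℝ) → ℝ) (s : Fin d → ℝ) :
    Matrix (Fin d) (Fin d) ℝ :=
  Matrix.of fun i j =>
    fderiv ℝ (fun t => fderiv ℝ φ t (Pi.single j (1 : ℝ))) s (Pi.single i (1 : ℝ))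

/-- `θ₁` is the eigenvalue of `H` on `span {𝟏}` and `θp` the eigenvalue of `H` on the
orthogonal complement `{v : ∑ i, v i = 0}` (no condition on `θp` if that complement is zero). -/
def HasEigs {d : ℕ} (H : Matrix (Fin d) (Fin d) ℝ) (θ₁ θp : ℝ) : Prop :=
  (∀ v ∈ Submodule.span ℝ {(fun _ => 1 : Fin d → ℝ)}, H *ᵥ v = θ₁ • v) ∧
    ∀ v : Fin d → ℝ, ∑ i, v i = 0 → H *ᵥ v = θp • v

/-- The rate `-N σ^{2-2/N} (θ(E) - β⁻¹ θ(S_N))`. -/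
noncomputable def rate (N : ℕ) (β σ θE θS : ℝ) : ℝ :=
  -((N : ℝ) * σ ^ (2 - 2 / (N : ℝ)) * (θE - β⁻¹ * θS))

/-- The orbit `{σ Q : Q ∈ O_d}`. -/
def orbit (d : ℕ) (σ : ℝ) : Set (Matrix (Fin d) (Fin d) ℝ) :=
  {X | ∃ Q ∈ Matrix.orthogonalGroup (Fin d) ℝ, X = σ • Q}

/-- The tangent space at `X` of a submanifold `S` of the space of matrices: the span of the
velocities at `X` of the curves in `S` through `X`. -/
def tangentSpaceAt {d : ℕ} (S : Set (Matrix (Fin d) (Fin d) ℝ)) (X : Matrix (Fin d) (Fin d) ℝ) :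
    Submodule ℝ (Matrix (Fin d) (Fin d) ℝ) :=
  Submodule.span ℝ
    {Z | ∃ γ : ℝ → Matrix (Fin d) (Fin d) ℝ, (∀ t, γ t ∈ S) ∧ γ 0 = X ∧ HasDerivAt γ Z 0}

/-- The subspace `{Q S : Sᵀ = S, tr S = 0}`. -/
def shapeSpace {d : ℕ} (Q : Matrix (Fin d) (Fin d) ℝ) :
    Submodule ℝ (Matrix (Fin d) (Fin d) ℝ) where
  carrier := {Z | ∃ S : Matrix (Fin d) (Fin d) ℝ, Sᵀ = S ∧ S.trace = 0 ∧ Z = Q * S}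
  add_mem' := by
    rintro _ _ ⟨S, hS, tS, rfl⟩ ⟨T, hT, tT, rfl⟩
    exact ⟨S + T, by simp [hS, hT], by simp [tS, tT], by rw [mul_add]⟩
  zero_mem' := ⟨0, by simp, by simp, by simp⟩
  smul_mem' := by
    rintro a _ ⟨S, hS, tS, rfl⟩
    exact ⟨a • S, by simp [hS], by simp [tS], by simp⟩

end DLN

namespace DLN

variable {d : ℕ}

/-! At `X` all singular values coincide, so neither the individual singular values nor the singular
vectors are smooth there. What survives is symmetry. Near `X` the free energy is `Ψ` evaluated at
the eigenvalues of `Yᵀ * Y`, with `Ψ` symmetric and C² near `(σ², …, σ²)`.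

The squared overlaps of two orthonormal eigenbases form a doubly stochastic matrix, and they express
exactly both the trace pairing and the Frobenius distance of two symmetric matrices. Birkhoff's
theorem turns these sums into averages over permutations, and symmetry of `Ψ` lets its Taylor
estimate be averaged in the same way (`IsDiag.taylor_bound`). Hence the free energy is
differentiable at every `Y` near `X`, with Euclidean gradient `Y * (U * diagonal (2 ∂Ψ) * Uᵀ)`,
whatever eigenbasis `U` is chosen.

The operator `𝒜` scales the `i`-th singular direction by `N s_i ^ (2 - 2/N)`, so the Riemannian
gradient is `Y` times a vector function `v` of the eigenvalues of `Yᵀ * Y`. The balance equation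
says `v = 0` at `(σ², …, σ²)`. By symmetry the Hessian on the diagonal is `a I + b 𝟏𝟏ᵀ`, so the
derivative of the gradient sends `W` to `X * (a' M + b' tr(M) 1)`, with `M = Xᵀ * W + Wᵀ * X` and
`a'`, `b'` rescaled from `a`, `b` (`hasFDerivAt_mul_conj`). The spectrum is then read off: `M`
vanishes on orbit directions, is scalar along `X`, and is a traceless symmetric matrix on the shape
directions. -/

/-! ### Diagonalization of the Gram matrix and functional calculus. -/

/-- `U` is orthogonal and diagonalizes `M` with eigenvalues `l`. -/
structure IsDiag (M U : Matrix (Fin d) (Fin d) ℝ) (l : Fin d → ℝ) : Prop where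
  transpose_mul : Uᵀ * U = 1
  mul_transpose : U * Uᵀ = 1
  eq : M = U * diagonal l * Uᵀ

theorem exists_isDiag_sv (Y : Matrix (Fin d) (Fin d) ℝ) :
    ∃ U, IsDiag (Yᵀ * Y) U (fun i => sv Y i ^ 2) := by
  set T := Matrix.toEuclideanLin Y with hT
  have hn : Module.finrank ℝ (EuclideanSpace ℝ (Fin d)) = d := by simp
  set b := T.isSymmetric_adjoint_comp_self.eigenvectorBasis hn with hb
  let U : Matrix (Fin d) (Fin d) ℝ := Matrix.of fun i j => b j i
  have h1 : Uᵀ * U = 1 := by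
    ext i j
    have := b.inner_eq_ite i j
    simp only [PiLp.inner_apply, RCLike.inner_apply, conj_trivial] at this
    simp only [mul_apply, transpose_apply, of_apply, U, one_apply]
    rw [← this]
    exact Finset.sum_congr rfl fun k _ => mul_comm _ _
  have h2 : U * Uᵀ = 1 := mul_eq_one_comm.mp h1
  refine ⟨U, h1, h2, ?_⟩
  have h3 : (Yᵀ * Y) * U = U * diagonal (fun i => sv Y i ^ 2) := by
    ext i j
    have h := T.isSymmetric_adjoint_comp_self.apply_eigenvectorBasis hn j
    rw [← T.sq_singularValues_fin hn j, ← hb, hT,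
      ← Matrix.toEuclideanLin_conjTranspose_eq_adjoint] at h
    have h' := congrArg (fun v : EuclideanSpace ℝ (Fin d) => v i) h
    rw [mul_assoc, mul_diagonal]
    simp only [LinearMap.comp_apply, toLpLin_apply, PiLp.smul_apply, RCLike.ofReal_real_eq_id,
      id, smul_eq_mul, conjTranspose_eq_transpose_of_trivial] at h'
    rw [mul_comm, sv]
    exact h'
  rw [← h3, mul_assoc, h2, mul_one]

theorem sv_pos {Y : Matrix (Fin d) (Fin d) ℝ} (hY : IsUnit Y) (i : Fin d) : 0 < sv Y i := by
  refine (Matrix.toEuclideanLin Y).injective_iff_forall_lt_finrank_singularValues_pos.1 ?_ i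
    (by simp)
  intro v w h
  have h' := congrArg WithLp.ofLp h
  simp only [toLpLin_apply] at h'
  have := Matrix.mulVec_injective_of_isUnit hY h'
  exact WithLp.ofLp_injective 2 this

/-- The change of basis `W` between two eigenbases intertwines the eigenvalues: wherever `W i j ≠ 0`
the two eigenvalues agree, hence so do their images under `φ`. No continuity of `φ` is needed, and
any eigenbasis computes the functional calculus. -/
theorem IsDiag.cfc {M U : Matrix (Fin d) (Fin d) ℝ} {l : Fin d → ℝ} (h : IsDiag M U l)
    (φ : ℝ → ℝ) : cfc φ M = U * diagonal (fun i => φ (l i)) * Uᵀ := by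
  have hM : M.IsHermitian := by
    rw [h.eq]
    simp [IsHermitian, conjTranspose_eq_transpose_of_trivial, mul_assoc]
  rw [hM.cfc_eq, IsHermitian.cfc]
  have hs := hM.spectral_theorem
  rw [Unitary.conjStarAlgAut_apply] at hs ⊢
  set V : Matrix (Fin d) (Fin d) ℝ := (hM.eigenvectorUnitary : Matrix (Fin d) (Fin d) ℝ)
  have hV1 : star V * V = 1 := Unitary.coe_star_mul_self hM.eigenvectorUnitary
  have hV2 : V * star V = 1 := Unitary.coe_mul_star_self hM.eigenvectorUnitary
  set W := star V * U with hW
  have key : diagonal (hM.eigenvalues) * W = W * diagonal l := by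
    have e : star V * (V * diagonal hM.eigenvalues * star V) * U
        = star V * (U * diagonal l * Uᵀ) * U :=
      congrArg (fun A => star V * A * U) (hs.symm.trans h.eq)
    calc _ = star V * V * diagonal (hM.eigenvalues) * star V * U := by
            rw [hV1, one_mul, hW, mul_assoc]
      _ = star V * U * diagonal l * (Uᵀ * U) := by
            simp only [mul_assoc] at e ⊢
            exact e
      _ = _ := by rw [h.transpose_mul, mul_one]
  have key2 : diagonal (φ ∘ hM.eigenvalues) * W = W * diagonal (fun i => φ (l i)) := by
    ext i j
    have := congrFun (congrFun key i) j
    rw [diagonal_mul, mul_diagonal] at this ⊢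
    rcases eq_or_ne (W i j) 0 with h0 | h0
    · simp [h0]
    · rw [mul_comm] at this
      rw [mul_comm, Function.comp, mul_left_cancel₀ h0 this]
  calc V * diagonal (φ ∘ hM.eigenvalues) * star V
      = V * (diagonal (φ ∘ hM.eigenvalues) * W) * Uᵀ := by
        rw [hW]; simp only [mul_assoc]; rw [h.mul_transpose, mul_one]
    _ = V * (W * diagonal (fun i => φ (l i))) * Uᵀ := by rw [key2]
    _ = _ := by rw [hW, ← mul_assoc V, ← mul_assoc V, hV2, one_mul]

/-! ### Comparing two symmetric matrices through Birkhoff's theorem. -/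

/-- The squared overlaps of two orthonormal bases form a doubly stochastic matrix, which by
Birkhoff's theorem averages over permutations. -/
theorem exists_perm_weights {U U' : Matrix (Fin d) (Fin d) ℝ} (h1 : Uᵀ * U = 1)
    (h1' : U'ᵀ * U' = 1) :
    ∃ w : Equiv.Perm (Fin d) → ℝ, (∀ π, 0 ≤ w π) ∧ ∑ π, w π = 1 ∧
      ∀ F : Fin d → Fin d → ℝ,
        ∑ i, ∑ j, (Uᵀ * U') i j ^ 2 * F i j = ∑ π, w π * ∑ i, F i (π i) := by
  set W := Uᵀ * U' with hW
  have hW1 : Wᵀ * W = 1 := by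
    rw [hW, transpose_mul, transpose_transpose, mul_assoc, ← mul_assoc U,
      mul_eq_one_comm.mp h1, one_mul, h1']
  have hW2 : W * Wᵀ = 1 := mul_eq_one_comm.mp hW1
  have hds : (Matrix.of fun i j => W i j ^ 2) ∈ doublyStochastic ℝ (Fin d) := by
    rw [mem_doublyStochastic_iff_sum]
    refine ⟨fun i j => sq_nonneg _, fun i => ?_, fun j => ?_⟩
    · have := congrFun (congrFun hW2 i) i
      simpa [mul_apply, sq] using this
    · have := congrFun (congrFun hW1 j) j
      simpa [mul_apply, sq] using this
  obtain ⟨w, hw0, hw1, hw⟩ := exists_eq_sum_perm_of_mem_doublyStochastic hds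
  refine ⟨w, hw0, hw1, fun F => ?_⟩
  have e : ∀ i j, W i j ^ 2 = ∑ π, w π * (if π i = j then 1 else 0) := by
    intro i j
    have := congrFun (congrFun hw i) j
    simp only [Matrix.sum_apply, Matrix.smul_apply, of_apply, smul_eq_mul, PEquiv.toMatrix_apply,
      Equiv.toPEquiv_apply, Option.mem_def, Option.some.injEq] at this
    exact this.symm
  simp_rw [e, Finset.sum_mul]
  have e2 : ∀ i, ∑ j, ∑ π, w π * (if π i = j then 1 else 0) * F i j = ∑ π, w π * F i (π i) := by
    intro i
    rw [Finset.sum_comm]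
    simp
  simp_rw [e2, Finset.mul_sum]
  rw [Finset.sum_comm]

theorem trace_conj_mul_conj (U U' : Matrix (Fin d) (Fin d) ℝ) (a b : Fin d → ℝ) :
    trace (U * diagonal a * Uᵀ * (U' * diagonal b * U'ᵀ))
      = ∑ i, ∑ j, (Uᵀ * U') i j ^ 2 * (a i * b j) := by
  have : trace (U * diagonal a * Uᵀ * (U' * diagonal b * U'ᵀ))
      = trace ((diagonal a * (Uᵀ * U')) * (diagonal b * (Uᵀ * U')ᵀ)) := by
    rw [transpose_mul, transpose_transpose, mul_assoc U, mul_assoc U, trace_mul_comm]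
    simp only [mul_assoc]
  rw [this]
  simp only [trace, diag, mul_apply (M := diagonal a * (Uᵀ * U')), diagonal_mul, transpose_apply]
  refine Finset.sum_congr rfl fun i _ => Finset.sum_congr rfl fun j _ => by ring

theorem IsDiag.transpose_eq {M U : Matrix (Fin d) (Fin d) ℝ} {l : Fin d → ℝ} (h : IsDiag M U l) :
    Mᵀ = M := by
  rw [h.eq]; simp [mul_assoc]

theorem IsDiag.conj_mul_conj {M U : Matrix (Fin d) (Fin d) ℝ} {l : Fin d → ℝ} (h : IsDiag M U l)
    (a b : Fin d → ℝ) : U * diagonal a * Uᵀ * (U * diagonal b * Uᵀ)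
      = U * diagonal (fun i => a i * b i) * Uᵀ := by
  rw [← diagonal_mul_diagonal]
  calc _ = U * diagonal a * (Uᵀ * U) * diagonal b * Uᵀ := by simp only [mul_assoc]
    _ = _ := by rw [h.transpose_mul, mul_one]; simp only [mul_assoc]

theorem IsDiag.conj_one {M U : Matrix (Fin d) (Fin d) ℝ} {l : Fin d → ℝ} (h : IsDiag M U l) :
    U * Matrix.diagonal (fun _ => (1 : ℝ)) * Uᵀ = 1 := by
  rw [diagonal_one, mul_one, h.mul_transpose]

theorem IsDiag.trace_conj_mul_sub {M U M' U' : Matrix (Fin d) (Fin d) ℝ} {l l' : Fin d → ℝ}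
    (h : IsDiag M U l) (h' : IsDiag M' U' l') (a : Fin d → ℝ) :
    trace (U * diagonal a * Uᵀ * (M' - M))
      = ∑ i, ∑ j, (Uᵀ * U') i j ^ 2 * (a i * (l' j - l i)) := by
  have e1 : trace (U * diagonal a * Uᵀ * M') = ∑ i, ∑ j, (Uᵀ * U') i j ^ 2 * (a i * l' j) := by
    rw [h'.eq, trace_conj_mul_conj]
  -- The identity is written in the basis `U'`, so that a trace involving only `U` also becomes a
  -- sum over the overlaps.
  have e2 : trace (U * diagonal a * Uᵀ * M)
      = ∑ i, ∑ j, (Uᵀ * U') i j ^ 2 * ((a i * l i) * 1) := by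
    rw [← trace_conj_mul_conj, h'.conj_one, mul_one, h.eq, h.conj_mul_conj]
  rw [mul_sub, trace_sub, e1, e2]
  simp_rw [← Finset.sum_sub_distrib]
  refine Finset.sum_congr rfl fun i _ => Finset.sum_congr rfl fun j _ => by ring

theorem IsDiag.sum_sq_sub {M U M' U' : Matrix (Fin d) (Fin d) ℝ} {l l' : Fin d → ℝ}
    (h : IsDiag M U l) (h' : IsDiag M' U' l') :
    ∑ i, ∑ j, (M' i j - M i j) ^ 2 = ∑ i, ∑ j, (Uᵀ * U') i j ^ 2 * (l' j - l i) ^ 2 := by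
  have e0 : ∑ i, ∑ j, (M' i j - M i j) ^ 2 = trace ((M' - M) * (M' - M)) := by
    simp only [trace, diag, mul_apply]
    refine Finset.sum_congr rfl fun i _ => Finset.sum_congr rfl fun j _ => ?_
    have : (M' - M) j i = (M' - M) i j := by
      conv_rhs => rw [← h.transpose_eq, ← h'.transpose_eq]
      simp
    rw [this, sq]; simp
  have e1 : (M' - M) * (M' - M) = M' * (M' - M) - M * (M' - M) := sub_mul _ _ _
  have e2 : trace (M' * (M' - M)) = ∑ i, ∑ j, (Uᵀ * U') i j ^ 2 * (1 * (l' j) ^ 2)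
      - ∑ i, ∑ j, (Uᵀ * U') i j ^ 2 * (l i * l' j) := by
    rw [mul_sub, trace_sub]
    congr 1
    · rw [← trace_conj_mul_conj, h.conj_one, one_mul, h'.eq, h'.conj_mul_conj]
      simp only [sq]
    · rw [trace_mul_comm, h.eq, h'.eq, trace_conj_mul_conj]
  have e3 : trace (M * (M' - M))
      = ∑ i, ∑ j, (Uᵀ * U') i j ^ 2 * (l i * (l' j - l i)) := by
    nth_rewrite 1 [h.eq]
    exact h.trace_conj_mul_sub h' l
  rw [e0, e1, trace_sub, e2, e3]
  simp_rw [← Finset.sum_sub_distrib]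
  refine Finset.sum_congr rfl fun i _ => Finset.sum_congr rfl fun j _ => by ring

/-- A symmetric function of the eigenvalues inherits a quadratic first-order Taylor estimate. -/
theorem IsDiag.taylor_bound {Ψ : (Fin d → ℝ) → ℝ} {v : (Fin d → ℝ) → Fin d → ℝ}
    {B : Set (Fin d → ℝ)} {C : ℝ}
    (hB : ∀ x ∈ B, ∀ π : Equiv.Perm (Fin d), (fun i => x (π i)) ∈ B)
    (hΨ : ∀ x, ∀ π : Equiv.Perm (Fin d), Ψ (fun i => x (π i)) = Ψ x)
    (hq : ∀ x ∈ B, ∀ y ∈ B, |Ψ y - Ψ x - ∑ i, v x i * (y i - x i)| ≤ C * ∑ i, (y i - x i) ^ 2)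
    {M U M' U' : Matrix (Fin d) (Fin d) ℝ} {l l' : Fin d → ℝ}
    (h : IsDiag M U l) (h' : IsDiag M' U' l') (hl : l ∈ B) (hl' : l' ∈ B) :
    |Ψ l' - Ψ l - trace (U * diagonal (v l) * Uᵀ * (M' - M))|
      ≤ C * ∑ i, ∑ j, (M' i j - M i j) ^ 2 := by
  obtain ⟨w, hw0, hw1, hw⟩ := exists_perm_weights h.transpose_mul h'.transpose_mul
  rw [h.sum_sq_sub h', h.trace_conj_mul_sub h', hw fun i j => v l i * (l' j - l i),
    hw fun i j => (l' j - l i) ^ 2]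
  -- Symmetry of `Ψ` puts its increment into the same average over permutations as the trace and the
  -- Frobenius distance.
  have e : Ψ l' - Ψ l = ∑ π, w π * (Ψ (fun i => l' (π i)) - Ψ l) := by
    simp_rw [hΨ l', ← Finset.sum_mul, hw1, one_mul]
  rw [e, ← Finset.sum_sub_distrib, Finset.mul_sum]
  refine (Finset.abs_sum_le_sum_abs _ _).trans (Finset.sum_le_sum fun π _ => ?_)
  rw [← mul_sub, abs_mul, abs_of_nonneg (hw0 π), mul_left_comm C]
  exact mul_le_mul_of_nonneg_left (hq l hl _ (hB l' hl' π)) (hw0 π)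

/-- A scalar matrix is diagonal in every orthonormal basis, so the overlap matrix is the identity.
This controls the singular values near `X` without any perturbation theory. -/
theorem IsDiag.sum_sq_sub_scalar {M U : Matrix (Fin d) (Fin d) ℝ} {l : Fin d → ℝ}
    (h : IsDiag M U l) (s : ℝ) :
    ∑ i, (l i - s) ^ 2 = ∑ i, ∑ j, (M i j - (s • (1 : Matrix (Fin d) (Fin d) ℝ)) i j) ^ 2 := by
  have h1 : IsDiag (s • (1 : Matrix (Fin d) (Fin d) ℝ)) U (fun _ => s) := by
    refine ⟨h.transpose_mul, h.mul_transpose, ?_⟩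
    rw [← smul_one_eq_diagonal, mul_smul_comm, smul_mul_assoc, mul_one, h.mul_transpose]
  rw [h1.sum_sq_sub h, h.transpose_mul]
  simp [one_apply]

/-! ### The operator `𝒜` in singular coordinates and the Riemannian gradient. -/

/-- The singular value decomposition of an invertible matrix `Y = V diag(s) Uᵀ`. -/
theorem exists_svd {Y U : Matrix (Fin d) (Fin d) ℝ} {s : Fin d → ℝ} (hs : ∀ i, 0 < s i)
    (h : IsDiag (Yᵀ * Y) U (fun i => s i ^ 2)) :
    ∃ V, IsDiag (Y * Yᵀ) V (fun i => s i ^ 2) ∧ Y = V * diagonal s * Uᵀ := by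
  have hs' : ∀ i, s i ≠ 0 := fun i => (hs i).ne'
  have hV1 : (Y * U * diagonal (fun i => (s i)⁻¹))ᵀ * (Y * U * diagonal (fun i => (s i)⁻¹)) = 1 := by
    calc _ = diagonal (fun i => (s i)⁻¹) * (Uᵀ * (Yᵀ * Y) * U) * diagonal (fun i => (s i)⁻¹) := by
          simp only [transpose_mul, diagonal_transpose, mul_assoc]
      _ = diagonal (fun i => (s i)⁻¹) * ((Uᵀ * U) * diagonal (fun i => s i ^ 2) * (Uᵀ * U))
          * diagonal (fun i => (s i)⁻¹) := by rw [h.eq]; simp only [mul_assoc]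
      _ = 1 := by
          rw [h.transpose_mul, one_mul, mul_one, diagonal_mul_diagonal, diagonal_mul_diagonal,
            ← diagonal_one]
          congr 1; ext i; field_simp [hs' i]
  have hY : Y = Y * U * diagonal (fun i => (s i)⁻¹) * diagonal s * Uᵀ := by
    rw [mul_assoc (Y * U), diagonal_mul_diagonal]
    simp only [inv_mul_cancel₀ (hs' _), diagonal_one, mul_one]
    rw [mul_assoc, h.mul_transpose, mul_one]
  refine ⟨_, ⟨hV1, mul_eq_one_comm.mp hV1, ?_⟩, hY⟩
  generalize Y * U * diagonal (fun i => (s i)⁻¹) = V at hY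
  rw [hY]
  calc _ = V * diagonal s * (Uᵀ * U) * diagonal s * Vᵀ := by
        simp only [transpose_mul, diagonal_transpose, transpose_transpose, mul_assoc]
    _ = _ := by
        rw [h.transpose_mul, mul_one, mul_assoc V, diagonal_mul_diagonal]
        simp only [sq]

theorem opA_apply (N : ℕ) (Y P : Matrix (Fin d) (Fin d) ℝ) :
    opA N Y P = ∑ p ∈ Finset.Icc 1 N,
      cfc (fun t : ℝ => t ^ (((N : ℝ) - (p : ℝ)) / (N : ℝ))) (Y * Yᵀ) * P *
      cfc (fun t : ℝ => t ^ (((p : ℝ) - 1) / (N : ℝ))) (Yᵀ * Y) := by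
  simp [opA]

theorem transpose_cfc (φ : ℝ → ℝ) (M : Matrix (Fin d) (Fin d) ℝ) : (cfc φ M)ᵀ = cfc φ M := by
  have : IsSelfAdjoint (cfc φ M) := cfc_predicate φ M
  rwa [IsSelfAdjoint, star_eq_conjTranspose, conjTranspose_eq_transpose_of_trivial] at this

theorem trace_opA_transpose_mul (N : ℕ) (Y P R : Matrix (Fin d) (Fin d) ℝ) :
    trace ((opA N Y P)ᵀ * R) = trace (Pᵀ * opA N Y R) := by
  simp only [opA_apply, transpose_sum, Finset.sum_mul, Finset.mul_sum, trace_sum]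
  refine Finset.sum_congr rfl fun p _ => ?_
  rw [transpose_mul, transpose_mul, transpose_cfc, transpose_cfc, mul_assoc, trace_mul_comm]
  simp only [mul_assoc]

/-- In the bases `V`, `U` the operator multiplies each matrix entry by a sum of positive numbers, so
its kernel is trivial. -/
theorem isUnit_opA {N : ℕ} (hN : 0 < N) {Y U : Matrix (Fin d) (Fin d) ℝ} {s : Fin d → ℝ}
    (hs : ∀ i, 0 < s i) (h : IsDiag (Yᵀ * Y) U (fun i => s i ^ 2)) : IsUnit (opA N Y) := by
  obtain ⟨V, hV, -⟩ := exists_svd hs h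
  rw [LinearMap.isUnit_iff_ker_eq_bot, LinearMap.ker_eq_bot']
  intro P hP
  have h0 : ∀ i j, (Vᵀ * P * U) i j = 0 := by
    intro i j
    have e : Vᵀ * opA N Y P * U = ∑ p ∈ Finset.Icc 1 N,
        diagonal (fun i => (s i ^ 2) ^ (((N : ℝ) - (p : ℝ)) / (N : ℝ))) * (Vᵀ * P * U) *
        diagonal (fun i => (s i ^ 2) ^ (((p : ℝ) - 1) / (N : ℝ))) := by
      rw [opA_apply, Finset.mul_sum, Finset.sum_mul]
      refine Finset.sum_congr rfl fun p _ => ?_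
      rw [hV.cfc, h.cfc]
      calc _ = (Vᵀ * V) * diagonal (fun i => (s i ^ 2) ^ (((N : ℝ) - (p : ℝ)) / (N : ℝ))) * Vᵀ * P
            * U * diagonal (fun i => (s i ^ 2) ^ (((p : ℝ) - 1) / (N : ℝ))) * (Uᵀ * U) := by
              simp only [mul_assoc]
        _ = _ := by rw [hV.transpose_mul, h.transpose_mul]; simp only [mul_assoc, one_mul, mul_one]
    rw [hP, mul_zero, zero_mul] at e
    have e' := congrFun (congrFun e i) j
    rw [Matrix.sum_apply] at e'
    simp only [mul_diagonal, diagonal_mul, Matrix.zero_apply, mul_right_comm _ ((Vᵀ * P * U) i j)] at e'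
    rw [← Finset.sum_mul] at e'
    refine (mul_eq_zero.mp e'.symm).resolve_left (ne_of_gt ?_)
    refine Finset.sum_pos (fun p _ => ?_) ⟨1, by simp; omega⟩
    have := hs i; have := hs j
    positivity
  have h1 : Vᵀ * P * U = 0 := by ext i j; exact h0 i j
  calc P = (V * Vᵀ) * P * (U * Uᵀ) := by rw [hV.mul_transpose, h.mul_transpose]; simp
    _ = V * (Vᵀ * P * U) * Uᵀ := by simp only [mul_assoc]
    _ = 0 := by rw [h1]; simp

/-- On matrices diagonal in the singular bases all `N` summands act alike: the exponents `(N-p)/N`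
and `(p-1)/N` of `s_i ^ 2` always add up to `1 - 1/N`. -/
theorem opA_mul_conj {N : ℕ} (hN : 0 < N) {Y U : Matrix (Fin d) (Fin d) ℝ} {s : Fin d → ℝ}
    (hs : ∀ i, 0 < s i) (h : IsDiag (Yᵀ * Y) U (fun i => s i ^ 2)) (v : Fin d → ℝ) :
    opA N Y (Y * (U * diagonal v * Uᵀ))
      = Y * (U * diagonal (fun i => N * s i ^ (2 - 2 / (N : ℝ)) * v i) * Uᵀ) := by
  obtain ⟨V, hV, hY⟩ := exists_svd hs h
  have hYU : ∀ a : Fin d → ℝ, Y * (U * diagonal a * Uᵀ)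
      = V * diagonal (fun i => s i * a i) * Uᵀ := by
    intro a
    rw [hY, ← diagonal_mul_diagonal]
    calc _ = V * diagonal s * (Uᵀ * U) * diagonal a * Uᵀ := by simp only [mul_assoc]
      _ = _ := by rw [h.transpose_mul, mul_one]; simp only [mul_assoc]
  rw [opA_apply, hYU, hYU]
  have hNr : (N : ℝ) ≠ 0 := by exact_mod_cast hN.ne'
  have e : ∀ p ∈ Finset.Icc 1 N,
      cfc (fun t : ℝ => t ^ (((N : ℝ) - (p : ℝ)) / (N : ℝ))) (Y * Yᵀ) *
        (V * diagonal (fun i => s i * v i) * Uᵀ) *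
        cfc (fun t : ℝ => t ^ (((p : ℝ) - 1) / (N : ℝ))) (Yᵀ * Y)
      = V * diagonal (fun i => s i * (s i ^ (2 - 2 / (N : ℝ)) * v i)) * Uᵀ := by
    intro p _
    rw [hV.cfc, h.cfc]
    calc _ = V * (diagonal (fun i => (s i ^ 2) ^ (((N : ℝ) - (p : ℝ)) / (N : ℝ))) * (Vᵀ * V)
            * diagonal (fun i => s i * v i) * (Uᵀ * U)
            * diagonal (fun i => (s i ^ 2) ^ (((p : ℝ) - 1) / (N : ℝ)))) * Uᵀ := by
              simp only [mul_assoc]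
      _ = _ := by
        rw [hV.transpose_mul, h.transpose_mul, mul_one, mul_one, diagonal_mul_diagonal,
          diagonal_mul_diagonal]
        congr 3
        ext i
        have hi := hs i
        have : s i ^ (2 - 2 / (N : ℝ)) = (s i ^ 2) ^ (((N : ℝ) - (p : ℝ)) / (N : ℝ))
            * (s i ^ 2) ^ (((p : ℝ) - 1) / (N : ℝ)) := by
          rw [← Real.rpow_add (by positivity), ← Real.rpow_natCast, ← Real.rpow_mul hi.le]
          congr 1
          push_cast
          field_simp
          ring
        rw [this]; ring
  rw [Finset.sum_congr rfl e, Finset.sum_const, Nat.card_Icc, Nat.add_sub_cancel,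
    ← smul_mul_assoc, ← mul_smul_comm, ← diagonal_smul]
  congr 3
  ext i
  simp only [Pi.smul_apply, nsmul_eq_mul]
  ring

/-- The Riemannian gradient exists and is obtained from the Euclidean one by applying `opA`. -/
theorem isGradAt_grad {N : ℕ} {F : Matrix (Fin d) (Fin d) ℝ → ℝ}
    {Y H : Matrix (Fin d) (Fin d) ℝ} (hu : IsUnit (opA N Y)) (hF : DifferentiableAt ℝ F Y)
    (hH : ∀ W, fderiv ℝ F Y W = trace (Hᵀ * W)) :
    IsGradAt N F Y (grad N F Y) ∧ grad N F Y = opA N Y H := by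
  have inv1 : ∀ W, opA N Y (Ring.inverse (opA N Y) W) = W := fun W => by
    rw [← Module.End.mul_apply, Ring.mul_inverse_cancel _ hu, Module.End.one_apply]
  have inv2 : ∀ W, Ring.inverse (opA N Y) (opA N Y W) = W := fun W => by
    rw [← Module.End.mul_apply, Ring.inverse_mul_cancel _ hu, Module.End.one_apply]
  have h1 : IsGradAt N F Y (opA N Y H) := by
    refine ⟨hF, fun W => ?_⟩
    rw [hH, metric, trace_opA_transpose_mul, inv1]
  have h2 : IsGradAt N F Y (grad N F Y) := Classical.epsilon_spec ⟨_, h1⟩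
  refine ⟨h2, ?_⟩
  -- Testing against `opA N Y W` turns the metric into the trace pairing, whose nondegeneracy
  -- identifies the gradient picked by `epsilon`.
  have h3 : ∀ W, trace ((grad N F Y - opA N Y H)ᵀ * W) = 0 := by
    intro W
    have a := (h2.2 (opA N Y W)).trans (h1.2 (opA N Y W)).symm
    rw [metric, metric, inv2] at a
    rw [transpose_sub, sub_mul, trace_sub, a, sub_self]
  have h4 := h3 (grad N F Y - opA N Y H)
  rw [← conjTranspose_eq_transpose_of_trivial, trace_conjTranspose_mul_self_eq_zero_iff] at h4
  exact sub_eq_zero.mp h4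

/-! ### Differentiating spectral functions near a scalar Gram matrix. -/

section Calculus

open Asymptotics

attribute [local instance] Matrix.normedAddCommGroup Matrix.normedSpace

theorem hasFDerivAt_matrix_mul {A B : Matrix (Fin d) (Fin d) ℝ → Matrix (Fin d) (Fin d) ℝ}
    {A' B' : Matrix (Fin d) (Fin d) ℝ →L[ℝ] Matrix (Fin d) (Fin d) ℝ}
    {X : Matrix (Fin d) (Fin d) ℝ} (hA : HasFDerivAt A A' X) (hB : HasFDerivAt B B' X) :
    ∃ L : Matrix (Fin d) (Fin d) ℝ →L[ℝ] Matrix (Fin d) (Fin d) ℝ,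
      HasFDerivAt (fun Y => A Y * B Y) L X ∧ ∀ W, L W = A X * B' W + A' W * B X := by
  refine ⟨_, (LinearMap.mul ℝ (Matrix (Fin d) (Fin d) ℝ)).toContinuousBilinearMap.hasFDerivAt_of_bilinear
    hA hB, fun W => rfl⟩

theorem hasFDerivAt_gram (X : Matrix (Fin d) (Fin d) ℝ) :
    ∃ L : Matrix (Fin d) (Fin d) ℝ →L[ℝ] Matrix (Fin d) (Fin d) ℝ,
      HasFDerivAt (fun Y => Yᵀ * Y) L X ∧ ∀ W, L W = Xᵀ * W + Wᵀ * X :=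
  hasFDerivAt_matrix_mul
    (A' := (Matrix.transposeLinearEquiv (Fin d) (Fin d) ℝ ℝ).toLinearMap.toContinuousLinearMap)
    ((Matrix.transposeLinearEquiv (Fin d) (Fin d) ℝ ℝ).toLinearMap.toContinuousLinearMap.hasFDerivAt)
    (hasFDerivAt_id X)

theorem sum_sq_le_norm_sq (A : Matrix (Fin d) (Fin d) ℝ) :
    ∑ i, ∑ j, A i j ^ 2 ≤ (d : ℝ) ^ 2 * ‖A‖ ^ 2 := by
  have : ∀ i j, A i j ^ 2 ≤ ‖A‖ ^ 2 := fun i j => by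
    rw [← sq_abs]
    exact pow_le_pow_left₀ (abs_nonneg _) (Matrix.norm_entry_le_entrywise_sup_norm A) 2
  calc _ ≤ ∑ _i : Fin d, ∑ _j : Fin d, ‖A‖ ^ 2 :=
        Finset.sum_le_sum fun i _ => Finset.sum_le_sum fun j _ => this i j
    _ = _ := by simp; ring

theorem norm_sq_le_sum_sq (x : Fin d → ℝ) : ‖x‖ ^ 2 ≤ ∑ i, x i ^ 2 := by
  have h0 : 0 ≤ ∑ i, x i ^ 2 := Finset.sum_nonneg fun i _ => sq_nonneg _
  rw [← Real.le_sqrt (norm_nonneg _) h0, pi_norm_le_iff_of_nonneg (Real.sqrt_nonneg _)]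
  intro i
  refine Real.le_sqrt_of_sq_le ?_
  rw [Real.norm_eq_abs, sq_abs]
  exact Finset.single_le_sum (f := fun i => x i ^ 2) (fun i _ => sq_nonneg _) (Finset.mem_univ i)

theorem norm_conj_diagonal_le {M U : Matrix (Fin d) (Fin d) ℝ} {l : Fin d → ℝ}
    (h : IsDiag M U l) (v : Fin d → ℝ) : ‖U * diagonal v * Uᵀ‖ ≤ d * ‖v‖ := by
  have hU : ∀ i j, |U i j| ≤ 1 := by
    intro i j
    have := congrFun (congrFun h.mul_transpose i) i
    simp only [mul_apply, transpose_apply, one_apply_eq, ← sq] at this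
    have h2 : U i j ^ 2 ≤ 1 := by
      rw [← this]
      exact Finset.single_le_sum (f := fun j => U i j ^ 2) (fun i _ => sq_nonneg _)
        (Finset.mem_univ j)
    exact abs_le_one_iff_mul_self_le_one.mpr (by rwa [← sq])
  rw [Matrix.norm_le_iff (by positivity)]
  intro i j
  rw [mul_apply]
  refine (norm_sum_le _ _).trans ?_
  calc _ ≤ ∑ _k : Fin d, ‖v‖ := Finset.sum_le_sum fun k _ => by
        rw [mul_diagonal, transpose_apply, norm_mul, norm_mul]
        have a := norm_le_pi_norm v k
        have b := hU i k
        have c := hU j k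
        rw [← Real.norm_eq_abs] at b c
        calc _ ≤ 1 * ‖v‖ * 1 := by gcongr
          _ = _ := by ring
    _ = _ := by simp

theorem norm_sv_sq_sub_le (Y : Matrix (Fin d) (Fin d) ℝ) (s : ℝ) :
    ‖(fun i => sv Y i ^ 2) - (fun _ => s)‖
      ≤ d * ‖Yᵀ * Y - s • (1 : Matrix (Fin d) (Fin d) ℝ)‖ := by
  obtain ⟨U, hU⟩ := exists_isDiag_sv Y
  refine le_of_sq_le_sq ?_ (by positivity)
  rw [mul_pow]
  refine (norm_sq_le_sum_sq _).trans ?_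
  refine le_trans (le_of_eq ?_) (sum_sq_le_norm_sq _)
  exact hU.sum_sq_sub_scalar s

theorem sv_sq_eq {X : Matrix (Fin d) (Fin d) ℝ} {s : ℝ}
    (hX : Xᵀ * X = s • (1 : Matrix (Fin d) (Fin d) ℝ)) :
    (fun i => sv X i ^ 2) = fun _ : Fin d => s := by
  have := norm_sv_sq_sub_le X s
  rw [hX, sub_self, norm_zero, mul_zero] at this
  exact sub_eq_zero.mp (norm_le_zero_iff.mp this)

theorem gram_sub_isBigO (X : Matrix (Fin d) (Fin d) ℝ) :
    (fun Y => Yᵀ * Y - Xᵀ * X) =O[𝓝 X] fun Y => Y - X := by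
  obtain ⟨L, hL, -⟩ := hasFDerivAt_gram X
  exact hL.isBigO_sub

theorem sv_sq_sub_isBigO {X : Matrix (Fin d) (Fin d) ℝ} {s : ℝ}
    (hX : Xᵀ * X = s • (1 : Matrix (Fin d) (Fin d) ℝ)) :
    (fun Y => (fun i => sv Y i ^ 2) - (fun _ => s)) =O[𝓝 X] fun Y => Y - X := by
  refine IsBigO.trans ?_ (gram_sub_isBigO X)
  refine IsBigO.of_bound d (Eventually.of_forall fun Y => ?_)
  rw [hX]
  exact norm_sv_sq_sub_le Y s

theorem tendsto_sv_sq {X : Matrix (Fin d) (Fin d) ℝ} {s : ℝ}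
    (hX : Xᵀ * X = s • (1 : Matrix (Fin d) (Fin d) ℝ)) :
    Tendsto (fun Y i => sv Y i ^ 2) (𝓝 X) (𝓝 fun _ => s) := by
  rw [tendsto_iff_norm_sub_tendsto_zero]
  have h : Tendsto (fun Y => Y - X) (𝓝 X) (𝓝 0) := by
    have := (tendsto_id (x := 𝓝 X)).sub (tendsto_const_nhds (x := X))
    rwa [sub_self] at this
  have := (sv_sq_sub_isBigO hX).trans_tendsto h
  exact tendsto_zero_iff_norm_tendsto_zero.mp this

/-- The vector of partial derivatives. -/
noncomputable def partials (Ψ : (Fin d → ℝ) → ℝ) (x : Fin d → ℝ) (i : Fin d) : ℝ :=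
  fderiv ℝ Ψ x (Pi.single i 1)

theorem fderiv_apply_eq_sum (Ψ : (Fin d → ℝ) → ℝ) (x v : Fin d → ℝ) :
    fderiv ℝ Ψ x v = ∑ i, partials Ψ x i * v i := by
  conv_lhs => rw [pi_eq_sum_univ' v]
  rw [map_sum]
  refine Finset.sum_congr rfl fun i _ => ?_
  rw [map_smul, smul_eq_mul, mul_comm, partials]

/-- The mean value inequality with a Lipschitz derivative. One constant serves all base points `x`
of the ball, as is needed for differentiability at every `Y` near `X`. -/
theorem exists_taylor_bound {Ψ : (Fin d → ℝ) → ℝ} {x₀ : Fin d → ℝ} (hΨ : ContDiffAt ℝ 2 Ψ x₀) :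
    ∃ r > 0, ∃ C : ℝ, 0 ≤ C ∧ ∀ x ∈ Metric.ball x₀ r, ∀ y ∈ Metric.ball x₀ r,
      |Ψ y - Ψ x - ∑ i, partials Ψ x i * (y i - x i)| ≤ C * ∑ i, (y i - x i) ^ 2 := by
  have h1 : ContDiffAt ℝ 1 (fderiv ℝ Ψ) x₀ := hΨ.fderiv_right (by norm_num)
  obtain ⟨K, t, ht, hK⟩ := h1.exists_lipschitzOnWith
  have h2 : ∀ᶠ x in 𝓝 x₀, DifferentiableAt ℝ Ψ x := by
    filter_upwards [hΨ.eventually (by simp)] with x hx using hx.differentiableAt (by norm_num)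
  obtain ⟨r, hr, hball⟩ := Metric.eventually_nhds_iff_ball.mp (h2.and ht)
  refine ⟨r, hr, K, K.2, fun x hx y hy => ?_⟩
  have hsub : segment ℝ x y ⊆ Metric.ball x₀ r := (convex_ball x₀ r).segment_subset hx hy
  have key := (convex_segment (𝕜 := ℝ) x y).norm_image_sub_le_of_norm_fderiv_le' (f := Ψ)
    (φ := fderiv ℝ Ψ x) (C := K * ‖y - x‖) (fun z hz => (hball z (hsub hz)).1) (fun z hz => ?_)
    (left_mem_segment ℝ x y) (right_mem_segment ℝ x y)
  · have e := fderiv_apply_eq_sum Ψ x (y - x)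
    simp only [Pi.sub_apply] at e
    rw [← e, ← Real.norm_eq_abs]
    refine key.trans ?_
    rw [mul_assoc, ← sq]
    exact mul_le_mul_of_nonneg_left (norm_sq_le_sum_sq (y - x)) K.2
  · refine (hK.norm_sub_le (hball z (hsub hz)).2 (hball x hx).2).trans ?_
    exact mul_le_mul_of_nonneg_left (norm_sub_le_of_mem_segment hz) K.2

/-- Differentiability near `X` of a symmetric function of the squared singular values, when all
singular values of `X` coincide. -/
theorem eventually_hasFDerivAt_spectral {Ψ : (Fin d → ℝ) → ℝ} {s : ℝ}
    (hsymm : ∀ x, ∀ π : Equiv.Perm (Fin d), Ψ (fun i => x (π i)) = Ψ x)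
    (hΨ : ContDiffAt ℝ 2 Ψ fun _ => s) {X : Matrix (Fin d) (Fin d) ℝ}
    (hX : Xᵀ * X = s • (1 : Matrix (Fin d) (Fin d) ℝ)) :
    ∀ᶠ Y in 𝓝 X, ∀ U, IsDiag (Yᵀ * Y) U (fun i => sv Y i ^ 2) →
      ∃ F' : Matrix (Fin d) (Fin d) ℝ →L[ℝ] ℝ,
        HasFDerivAt (fun Z => Ψ fun i => sv Z i ^ 2) F' Y ∧
        ∀ W, F' W = trace
          ((Y * (U * diagonal (fun i => 2 * partials Ψ (fun i => sv Y i ^ 2) i) * Uᵀ))ᵀ * W) := by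
  obtain ⟨r, hr, C, hC, hq⟩ := exists_taylor_bound hΨ
  have hev := (tendsto_sv_sq hX).eventually (Metric.ball_mem_nhds _ hr)
  filter_upwards [hev.eventually_nhds] with Y hY U hU
  set v := partials Ψ (fun i => sv Y i ^ 2)
  obtain ⟨G, hG⟩ : ∃ G, G = U * diagonal v * Uᵀ := ⟨_, rfl⟩
  have hGt : Gᵀ = G := by simp [hG, mul_assoc]
  have hball : ∀ x ∈ Metric.ball (fun _ : Fin d => s) r, ∀ π : Equiv.Perm (Fin d),
      (fun i => x (π i)) ∈ Metric.ball (fun _ : Fin d => s) r := by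
    intro x hx π
    rw [Metric.mem_ball, dist_pi_lt_iff hr] at hx ⊢
    exact fun i => hx (π i)
  let tr : Matrix (Fin d) (Fin d) ℝ →L[ℝ] ℝ :=
    ((Matrix.traceLinearMap (Fin d) ℝ ℝ).comp (LinearMap.mulLeft ℝ G)).toContinuousLinearMap
  have htr : ∀ W, tr W = trace (G * W) := fun W => rfl
  obtain ⟨L, hL, hLW⟩ := hasFDerivAt_gram Y
  have h1 := tr.hasFDerivAt.comp Y hL
  -- Once the candidate linear part is removed, the remainder is quadratic in `Zᵀ * Z - Yᵀ * Y`,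
  -- hence in `Z - Y`.
  have h2 : HasFDerivAt (fun Z => Ψ (fun i => sv Z i ^ 2) - Ψ (fun i => sv Y i ^ 2)
      - tr (Zᵀ * Z - Yᵀ * Y)) (0 : Matrix (Fin d) (Fin d) ℝ →L[ℝ] ℝ) Y := by
    refine IsBigO.hasFDerivAt (n := 2) ?_ (by norm_num)
    have hb : (fun Z => Ψ (fun i => sv Z i ^ 2) - Ψ (fun i => sv Y i ^ 2)
        - tr (Zᵀ * Z - Yᵀ * Y)) =O[𝓝 Y] fun Z => ‖Zᵀ * Z - Yᵀ * Y‖ ^ 2 := by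
      refine IsBigO.of_bound (C * (d : ℝ) ^ 2) ?_
      filter_upwards [hY] with Z hZ
      obtain ⟨U', hU'⟩ := exists_isDiag_sv Z
      have := hU.taylor_bound hball hsymm hq hU' hY.self_of_nhds hZ
      rw [← hG] at this
      rw [htr, Real.norm_eq_abs, Real.norm_of_nonneg (by positivity)]
      refine this.trans ?_
      rw [mul_assoc]
      exact mul_le_mul_of_nonneg_left (sum_sq_le_norm_sq (Zᵀ * Z - Yᵀ * Y)) hC
    refine hb.trans ?_
    exact ((gram_sub_isBigO Y).norm_norm.pow 2)
  refine ⟨tr.comp L, ?_, fun W => ?_⟩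
  · have h3 := (h2.add h1).add_const (Ψ (fun i => sv Y i ^ 2) - tr (Yᵀ * Y))
    refine (h3.congr_fderiv (zero_add _)).congr_of_eventuallyEq (Eventually.of_forall fun Z => ?_)
    simp only [Pi.add_apply, Function.comp, map_sub]
    ring
  -- The terms `Yᵀ * W` and `Wᵀ * Y` have the same trace against the symmetric `G`, whence the
  -- factor 2.
  · have e : (U * diagonal (fun i => 2 * v i) * Uᵀ) = (2 : ℝ) • G := by
      rw [hG, ← smul_mul_assoc, ← mul_smul_comm, ← diagonal_smul]; rfl
    rw [e, ContinuousLinearMap.comp_apply, hLW, htr, mul_add, trace_add, transpose_mul,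
      transpose_smul, hGt, smul_mul_assoc, smul_mul_assoc, trace_smul, ← trace_transpose (G * (Wᵀ * Y)),
      transpose_mul, transpose_mul, transpose_transpose, hGt, trace_mul_comm _ G, mul_assoc,
      smul_eq_mul, two_mul]

/-- First-order expansion at `X` of an equivariant matrix function of `Yᵀ Y` vanishing at `X`. -/
theorem hasFDerivAt_mul_conj {v : (Fin d → ℝ) → Fin d → ℝ} {s a b : ℝ}
    {v' : (Fin d → ℝ) →L[ℝ] (Fin d → ℝ)} (hv : HasFDerivAt v v' fun _ => s)
    (hv0 : v (fun _ => s) = 0) (hv' : ∀ x i, v' x i = a * x i + b * ∑ j, x j)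
    {X : Matrix (Fin d) (Fin d) ℝ}
    (hX : Xᵀ * X = s • (1 : Matrix (Fin d) (Fin d) ℝ))
    {U : Matrix (Fin d) (Fin d) ℝ → Matrix (Fin d) (Fin d) ℝ}
    (hU : ∀ Y, IsDiag (Yᵀ * Y) (U Y) (fun i => sv Y i ^ 2)) :
    ∃ L : Matrix (Fin d) (Fin d) ℝ →L[ℝ] Matrix (Fin d) (Fin d) ℝ,
      HasFDerivAt (fun Y => Y * (U Y * diagonal (v fun i => sv Y i ^ 2) * (U Y)ᵀ)) L X ∧
      ∀ W, L W = a • (X * (Xᵀ * W + Wᵀ * X)) + (b * trace (Xᵀ * W + Wᵀ * X)) • X := by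
  let A : Matrix (Fin d) (Fin d) ℝ →L[ℝ] Matrix (Fin d) (Fin d) ℝ :=
    (a • LinearMap.id + b • (Matrix.traceLinearMap (Fin d) ℝ ℝ).smulRight
      (1 : Matrix (Fin d) (Fin d) ℝ)).toContinuousLinearMap
  have hA : ∀ W, A W = a • W + b • trace W • (1 : Matrix (Fin d) (Fin d) ℝ) := fun W => rfl
  obtain ⟨L, hL, hLW⟩ := hasFDerivAt_gram X
  have hsX := sv_sq_eq hX
  -- `A` commutes with orthogonal conjugation, so it acts on matrices as `v'` acts on eigenvalues.
  -- The linear part is thus free of `U Y`, which need not be continuous in `Y`.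
  have hconj : ∀ Y, A (Yᵀ * Y - s • 1)
      = U Y * diagonal (v' ((fun i => sv Y i ^ 2) - fun _ => s)) * (U Y)ᵀ := by
    intro Y
    have e1 : Yᵀ * Y - s • 1
        = U Y * diagonal ((fun i => sv Y i ^ 2) - fun _ => s) * (U Y)ᵀ := by
      have : U Y * Matrix.diagonal (fun _ => s) * (U Y)ᵀ = s • 1 := by
        rw [← smul_one_eq_diagonal, mul_smul_comm, smul_mul_assoc, mul_one, (hU Y).mul_transpose]
      rw [(hU Y).eq, ← this, ← sub_mul, ← mul_sub, diagonal_sub]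
      rfl
    set x := (fun i => sv Y i ^ 2) - fun _ => s
    have e2 : trace (Yᵀ * Y - s • 1) = ∑ j, x j := by
      rw [e1, trace_mul_comm, ← mul_assoc, (hU Y).transpose_mul, one_mul, trace_diagonal]
    have e3 : v' x = a • x + fun _ => b * ∑ j, x j := by
      ext i; rw [hv']; simp
    have e4 : Matrix.diagonal (a • x + fun _ => b * ∑ j, x j)
        = diagonal (a • x) + Matrix.diagonal (fun _ => b * ∑ j, x j) := (diagonal_add _ _).symm
    rw [hA, e2, e1, e3, e4, mul_add, add_mul, diagonal_smul, mul_smul_comm,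
      smul_mul_assoc, ← smul_one_eq_diagonal, mul_smul_comm, smul_mul_assoc, mul_one,
      (hU Y).mul_transpose, smul_smul]
  obtain ⟨T, hT⟩ : ∃ T : Matrix (Fin d) (Fin d) ℝ → Matrix (Fin d) (Fin d) ℝ,
      T = fun Y => U Y * diagonal (v fun i => sv Y i ^ 2) * (U Y)ᵀ := ⟨_, rfl⟩
  have e : ∀ Y, T Y - A (Yᵀ * Y - s • 1) = U Y * diagonal (v (fun i => sv Y i ^ 2)
      - v' ((fun i => sv Y i ^ 2) - fun _ => s)) * (U Y)ᵀ := by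
    intro Y
    have : diagonal (v (fun i => sv Y i ^ 2) - v' ((fun i => sv Y i ^ 2) - fun _ => s))
        = diagonal (v (fun i => sv Y i ^ 2))
          - diagonal (v' ((fun i => sv Y i ^ 2) - fun _ => s)) := (diagonal_sub _ _).symm
    rw [hT, hconj, this, mul_sub, sub_mul]
  have hTX : T X = 0 := by
    rw [hT]
    simp only [hsX, hv0]
    rw [diagonal_zero', mul_zero, zero_mul]
  clear_value A
  have hder : HasFDerivAt T (A.comp L) X := by
    have h1 : HasFDerivAt (fun Y => A (Yᵀ * Y - s • 1)) (A.comp L) X :=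
      (A.hasFDerivAt (x := Xᵀ * X - s • 1)).comp X (hL.sub_const (s • 1))
    have h2 : HasFDerivAt (fun Y => T Y - A (Yᵀ * Y - s • 1))
        (0 : Matrix (Fin d) (Fin d) ℝ →L[ℝ] Matrix (Fin d) (Fin d) ℝ) X := by
      refine hasFDerivAt_iff_isLittleO.mpr ?_
      have ho := ((hasFDerivAt_iff_isLittleO.mp hv).comp_tendsto (tendsto_sv_sq hX)).trans_isBigO
        (sv_sq_sub_isBigO hX)
      refine IsBigO.trans_isLittleO ?_ ho
      -- Conjugation by an orthogonal matrix costs at most the factor `d`, uniformly in `Y`.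
      refine IsBigO.of_bound d (Eventually.of_forall fun Y => ?_)
      rw [hTX, hX, sub_self, map_zero, sub_self, e]
      have := norm_conj_diagonal_le (hU Y) (v (fun i => sv Y i ^ 2)
        - v' ((fun i => sv Y i ^ 2) - fun _ => s))
      have key : ‖U Y * diagonal (v (fun i => sv Y i ^ 2)
          - v' ((fun i => sv Y i ^ 2) - fun _ => s)) * (U Y)ᵀ - 0 - 0‖
          ≤ d * ‖v (fun i => sv Y i ^ 2) - v (fun _ => s)
            - v' ((fun i => sv Y i ^ 2) - fun _ => s)‖ := by
        rw [sub_zero, sub_zero, hv0, sub_zero]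
        exact this
      exact key
    refine ((h2.add h1).congr_fderiv (zero_add _)).congr_of_eventuallyEq
      (Eventually.of_forall fun Z => ?_)
    exact (sub_add_cancel _ _).symm
  obtain ⟨L', hL', hL'W⟩ := hasFDerivAt_matrix_mul (hasFDerivAt_id X) hder
  refine ⟨L', by rw [hT] at hL'; exact hL', fun W => ?_⟩
  rw [hL'W, hTX, mul_zero, add_zero, ContinuousLinearMap.comp_apply, hLW, hA]
  simp only [id, mul_add, mul_smul_comm, mul_one, smul_add, smul_smul]

theorem hasFDerivAt_matrix_neg {A : Matrix (Fin d) (Fin d) ℝ → Matrix (Fin d) (Fin d) ℝ}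
    {A' : Matrix (Fin d) (Fin d) ℝ →L[ℝ] Matrix (Fin d) (Fin d) ℝ}
    {X : Matrix (Fin d) (Fin d) ℝ} (hA : HasFDerivAt A A' X) :
    HasFDerivAt (fun Y => -A Y) (-A') X :=
  HasFDerivAt.fun_neg hA

end Calculus

/-! ### Symmetric functions at a diagonal point and squared variables. -/

/-- Precomposition with a permutation, as a continuous linear equivalence. -/
noncomputable def permCLE (π : Equiv.Perm (Fin d)) : (Fin d → ℝ) ≃L[ℝ] (Fin d → ℝ) :=
  (LinearEquiv.funCongrLeft ℝ ℝ π).toContinuousLinearEquiv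

theorem permCLE_apply (π : Equiv.Perm (Fin d)) (x : Fin d → ℝ) :
    permCLE π x = fun i => x (π i) := rfl

theorem permCLE_single (π : Equiv.Perm (Fin d)) (i : Fin d) :
    permCLE π (Pi.single (π i) 1) = Pi.single i 1 := by
  ext k
  simp [permCLE_apply, Pi.single_apply]

theorem partials_perm {φ : (Fin d → ℝ) → ℝ}
    (hφ : ∀ x, ∀ π : Equiv.Perm (Fin d), φ (fun i => x (π i)) = φ x)
    (π : Equiv.Perm (Fin d)) (x : Fin d → ℝ) (i : Fin d) :
    partials φ x (π i) = partials φ (fun k => x (π k)) i := by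
  have h : φ ∘ permCLE π = φ := funext fun y => hφ y π
  have h2 := (permCLE π).comp_right_fderiv (f := φ) (x := x)
  rw [h] at h2
  rw [partials, h2, ContinuousLinearMap.comp_apply]
  change fderiv ℝ φ (permCLE π x) (permCLE π (Pi.single (π i) 1)) = _
  rw [permCLE_single]
  rfl

theorem hess_perm {φ : (Fin d → ℝ) → ℝ}
    (hφ : ∀ x, ∀ π : Equiv.Perm (Fin d), φ (fun i => x (π i)) = φ x)
    (π : Equiv.Perm (Fin d)) (s : ℝ) (i j : Fin d) :
    hess φ (fun _ => s) (π i) (π j) = hess φ (fun _ => s) i j := by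
  have h : (fun t => partials φ t (π j)) = (fun t => partials φ t j) ∘ permCLE π :=
    funext fun t => partials_perm hφ π t j
  change fderiv ℝ (fun t => partials φ t (π j)) _ _ = fderiv ℝ (fun t => partials φ t j) _ _
  rw [h, (permCLE π).comp_right_fderiv, ContinuousLinearMap.comp_apply]
  change fderiv ℝ (fun t => partials φ t j) (permCLE π fun _ => s)
    (permCLE π (Pi.single (π i) 1)) = _
  rw [permCLE_single]
  rfl

/-- The Hessian of a symmetric function at a point of the diagonal is `a I + b 𝟏𝟏ᵀ`. -/
theorem exists_hess_eq {φ : (Fin d → ℝ) → ℝ}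
    (hφ : ∀ x, ∀ π : Equiv.Perm (Fin d), φ (fun i => x (π i)) = φ x) (s : ℝ) :
    ∃ a b : ℝ, ∀ i j, hess φ (fun _ => s) i j = a * (if i = j then 1 else 0) + b := by
  by_cases hne : ∃ i₀ i₁ : Fin d, i₁ ≠ i₀
  · obtain ⟨i₀, i₁, hi⟩ := hne
    refine ⟨hess φ (fun _ => s) i₀ i₀ - hess φ (fun _ => s) i₀ i₁, hess φ (fun _ => s) i₀ i₁,
      fun i j => ?_⟩
    split_ifs with hij
    · subst hij
      have := hess_perm hφ (Equiv.swap i₀ i) s i₀ i₀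
      rw [Equiv.swap_apply_left] at this
      rw [this]; ring
    -- The first swap takes `i₀` to `i`; the second takes the image of `i₁` to `j` and leaves `i`
    -- fixed.
    · have := hess_perm hφ (Equiv.swap (Equiv.swap i₀ i i₁) j * Equiv.swap i₀ i) s i₀ i₁
      have h1 : Equiv.swap i₀ i i₁ ≠ i := fun h => hi <| (Equiv.swap i₀ i).injective <| by
        rw [h, Equiv.swap_apply_left]
      rw [Equiv.Perm.mul_apply, Equiv.Perm.mul_apply, Equiv.swap_apply_left,
        Equiv.swap_apply_left, Equiv.swap_apply_of_ne_of_ne h1.symm hij] at this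
      rw [this]; ring
  · push Not at hne
    rcases Nat.eq_zero_or_pos d with rfl | hd
    · exact ⟨0, 0, fun i => i.elim0⟩
    · refine ⟨hess φ (fun _ => s) ⟨0, hd⟩ ⟨0, hd⟩, 0, fun i j => ?_⟩
      rw [hne ⟨0, hd⟩ i, hne ⟨0, hd⟩ j]
      simp

theorem hasEigs_of_eq {H : Matrix (Fin d) (Fin d) ℝ} {a b : ℝ}
    (h : ∀ i j, H i j = a * (if i = j then 1 else 0) + b) : HasEigs H (a + b * d) a := by
  have key : ∀ v : Fin d → ℝ, ∀ i, (H *ᵥ v) i = a * v i + b * ∑ j, v j := by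
    intro v i
    simp only [mulVec, dotProduct, h, add_mul, Finset.sum_add_distrib, Finset.mul_sum]
    simp
  refine ⟨fun v hv => ?_, fun v hv => ?_⟩
  · obtain ⟨c, rfl⟩ := Submodule.mem_span_singleton.mp hv
    ext i
    rw [key]
    simp
    ring
  · ext i
    rw [key, hv]
    simp

theorem differentiableAt_partials {φ : (Fin d → ℝ) → ℝ} {x : Fin d → ℝ}
    (hφ : ContDiffAt ℝ 2 φ x) (i : Fin d) : DifferentiableAt ℝ (fun t => partials φ t i) x := by
  have h1 : ContDiffAt ℝ 1 (fderiv ℝ φ) x := hφ.fderiv_right (by norm_num)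
  exact (h1.differentiableAt (by norm_num)).clm_apply (differentiableAt_const _)

theorem eventually_differentiableAt {φ : (Fin d → ℝ) → ℝ} {x : Fin d → ℝ}
    (hφ : ContDiffAt ℝ 2 φ x) : ∀ᶠ y in 𝓝 x, DifferentiableAt ℝ φ y := by
  filter_upwards [hφ.eventually (by simp)] with y hy using hy.differentiableAt (by norm_num)

theorem hess_sub_const_mul {φ ψ : (Fin d → ℝ) → ℝ} {x : Fin d → ℝ}
    (hφ : ContDiffAt ℝ 2 φ x) (hψ : ContDiffAt ℝ 2 ψ x) (c : ℝ) (i j : Fin d) :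
    hess (fun t => φ t - c * ψ t) x i j = hess φ x i j - c * hess ψ x i j := by
  change fderiv ℝ (fun t => partials (fun t => φ t - c * ψ t) t j) x _
    = fderiv ℝ (fun t => partials φ t j) x _ - c * fderiv ℝ (fun t => partials ψ t j) x _
  have e : (fun t => partials (fun t => φ t - c * ψ t) t j)
      =ᶠ[𝓝 x] fun t => partials φ t j - c * partials ψ t j := by
    filter_upwards [eventually_differentiableAt hφ, eventually_differentiableAt hψ] with y h1 h2
    rw [partials, fderiv_fun_sub h1 (h2.const_mul c), fderiv_const_mul h2]
    rfl
  have h1 := differentiableAt_partials hφ j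
  have h2 := differentiableAt_partials hψ j
  rw [e.fderiv_eq, fderiv_fun_sub h1 (h2.const_mul c), fderiv_const_mul h2]
  rfl

theorem fderiv_partials_apply {φ : (Fin d → ℝ) → ℝ} {x : Fin d → ℝ} {a b : ℝ}
    (h : ∀ i j, hess φ x i j = a * (if i = j then 1 else 0) + b) (i : Fin d) (v : Fin d → ℝ) :
    fderiv ℝ (fun t => partials φ t i) x v = a * v i + b * ∑ j, v j := by
  rw [fderiv_apply_eq_sum]
  have : ∀ j, partials (fun t => partials φ t i) x j = hess φ x j i := fun j => rfl
  simp only [this, h, add_mul, Finset.sum_add_distrib, Finset.mul_sum]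
  simp

theorem hasFDerivAt_sqrt_comp {l : Fin d → ℝ} (hl : ∀ i, 0 < l i) :
    ∃ D : (Fin d → ℝ) →L[ℝ] (Fin d → ℝ), HasFDerivAt (fun m : Fin d → ℝ => fun i => √(m i)) D l ∧
      ∀ x i, D x i = 1 / (2 * √(l i)) * x i := by
  refine ⟨ContinuousLinearMap.pi fun i => (1 / (2 * √(l i))) •
    (ContinuousLinearMap.proj i : (Fin d → ℝ) →L[ℝ] ℝ), ?_, fun x i => rfl⟩
  rw [hasFDerivAt_pi]
  intro i
  exact (ContinuousLinearMap.proj (R := ℝ) (φ := fun _ : Fin d => ℝ) i).hasFDerivAt.sqrt (hl i).ne'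

theorem contDiffAt_comp_sqrt {φ : (Fin d → ℝ) → ℝ} {σ : ℝ} (hσ : 0 < σ)
    (hφ : ContDiffAt ℝ 2 φ fun _ => σ) :
    ContDiffAt ℝ 2 (fun m : Fin d → ℝ => φ fun i => √(m i)) fun _ => σ ^ 2 := by
  have h : ContDiffAt ℝ 2 (fun m : Fin d → ℝ => fun i => √(m i)) fun _ => σ ^ 2 := by
    rw [contDiffAt_pi]
    intro i
    exact (contDiffAt_apply ℝ ℝ i _).sqrt (by positivity)
  refine ContDiffAt.comp (g := φ) _ ?_ h
  simpa [Real.sqrt_sq hσ.le] using hφ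

/-- The derivative at a critical point of the gradient field of `φ`, written in the squared
variables and rescaled. -/
theorem hasFDerivAt_rescaled_partials {φ : (Fin d → ℝ) → ℝ} {σ a b : ℝ} (hσ : 0 < σ)
    (hφ : ContDiffAt ℝ 2 φ fun _ => σ) (h0 : ∀ i, partials φ (fun _ => σ) i = 0)
    (hH : ∀ i j, hess φ (fun _ => σ) i j = a * (if i = j then 1 else 0) + b) (N e : ℝ) :
    ∃ v' : (Fin d → ℝ) →L[ℝ] (Fin d → ℝ),
      HasFDerivAt (fun l i => N * √(l i) ^ e *
        (2 * partials (fun m : Fin d → ℝ => φ fun k => √(m k)) l i)) v' (fun _ => σ ^ 2) ∧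
      ∀ x i, v' x i = N * σ ^ e * a / (2 * σ ^ 2) * x i
        + N * σ ^ e * b / (2 * σ ^ 2) * ∑ j, x j := by
  have hs : √(σ ^ 2) = σ := Real.sqrt_sq hσ.le
  obtain ⟨D, hD, hDx⟩ := hasFDerivAt_sqrt_comp (d := d) (l := fun _ => σ ^ 2)
    (fun _ => by positivity)
  have hev : ∀ᶠ l : Fin d → ℝ in 𝓝 (fun _ => σ ^ 2), ∀ i, N * √(l i) ^ e *
        (2 * partials (fun m : Fin d → ℝ => φ fun k => √(m k)) l i)
      = (N * √(l i) ^ e / √(l i)) * partials φ (fun k => √(l k)) i := by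
    have hpos : ∀ᶠ l : Fin d → ℝ in 𝓝 (fun _ => σ ^ 2), ∀ i, 0 < l i := by
      rw [eventually_all]
      intro i
      exact (continuous_apply i).continuousAt.eventually (lt_mem_nhds (by positivity))
    have hdiff : ∀ᶠ l : Fin d → ℝ in 𝓝 (fun _ => σ ^ 2),
        DifferentiableAt ℝ φ (fun k => √(l k)) := by
      refine hD.continuousAt.eventually ?_
      simpa [hs] using eventually_differentiableAt hφ
    filter_upwards [hpos, hdiff] with l hl hd i
    obtain ⟨D', hD', hD'x⟩ := hasFDerivAt_sqrt_comp hl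
    have hc : HasFDerivAt (fun m : Fin d → ℝ => φ fun k => √(m k))
        ((fderiv ℝ φ fun k => √(l k)).comp D') l := hd.hasFDerivAt.comp l hD'
    have : partials (fun m : Fin d → ℝ => φ fun k => √(m k)) l i
        = 1 / (2 * √(l i)) * partials φ (fun k => √(l k)) i := by
      rw [partials, hc.fderiv, ContinuousLinearMap.comp_apply, fderiv_apply_eq_sum]
      simp only [hD'x, Pi.single_apply]
      simp [mul_comm]
    have hli := Real.sqrt_pos.mpr (hl i)
    rw [this]
    field_simp
  let v' : (Fin d → ℝ) →L[ℝ] (Fin d → ℝ) := ContinuousLinearMap.pi fun i =>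
    (N * σ ^ e / σ) • (fderiv ℝ (fun t => partials φ t i) (fun _ => σ)).comp D
  refine ⟨v', ?_, fun x i => ?_⟩
  · rw [hasFDerivAt_pi]
    intro i
    have h1 : HasFDerivAt (fun l : Fin d → ℝ => partials φ (fun k => √(l k)) i)
        ((fderiv ℝ (fun t => partials φ t i) (fun _ => σ)).comp D) (fun _ => σ ^ 2) := by
      refine HasFDerivAt.comp (g := fun t => partials φ t i) _ ?_ hD
      simp only [hs]
      exact (differentiableAt_partials hφ i).hasFDerivAt
    have h2 : DifferentiableAt ℝ (fun l : Fin d → ℝ => N * √(l i) ^ e / √(l i))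
        (fun _ => σ ^ 2) := by
      have h3 : DifferentiableAt ℝ (fun l : Fin d → ℝ => √(l i)) (fun _ => σ ^ 2) :=
        (differentiableAt_apply i _).sqrt (by positivity)
      have h4 : √((fun _ : Fin d => σ ^ 2) i) ≠ 0 := by simpa [hs] using hσ.ne'
      have h6 : DifferentiableAt ℝ (fun l : Fin d → ℝ => N * √(l i) ^ e) (fun _ => σ ^ 2) :=
        (h3.rpow_const (Or.inl h4)).const_mul N
      simp only [div_eq_mul_inv]
      exact h6.mul (h3.fun_inv h4)
    -- The derivative of the prefactor is never computed: it is multiplied by a partial derivative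
    -- of `φ` that vanishes at the critical point.
    have h5 := h2.hasFDerivAt.mul h1
    refine (h5.congr_fderiv ?_).congr_of_eventuallyEq (hev.mono fun l hl => hl i)
    simp [hs, h0]
  · change (N * σ ^ e / σ) * fderiv ℝ (fun t => partials φ t i) (fun _ => σ) (D x) = _
    rw [fderiv_partials_apply hH]
    simp only [hDx, hs, ← Finset.mul_sum]
    field_simp

/-- By symmetry the partial derivatives at a diagonal point are all equal, so a single scalar
equation along the diagonal makes them all vanish. -/
theorem partials_eq_zero {φ : (Fin d → ℝ) → ℝ} {σ : ℝ}
    (hφ : ∀ x, ∀ π : Equiv.Perm (Fin d), φ (fun i => x (π i)) = φ x)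
    (hdiff : DifferentiableAt ℝ φ fun _ => σ)
    (h : HasDerivAt (fun t : ℝ => φ fun _ => t) 0 σ) (i : Fin d) :
    partials φ (fun _ => σ) i = 0 := by
  have h1 : HasDerivAt (fun t : ℝ => fun _ : Fin d => t) (fun _ => 1) σ := by
    rw [hasDerivAt_pi]
    exact fun _ => hasDerivAt_id σ
  have h2 := (hdiff.hasFDerivAt.comp_hasDerivAt σ h1).unique h
  rw [fderiv_apply_eq_sum] at h2
  have h3 : ∀ j, partials φ (fun _ => σ) j = partials φ (fun _ => σ) i := by
    intro j
    have := partials_perm hφ (Equiv.swap i j) (fun _ => σ) i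
    rwa [Equiv.swap_apply_left] at this
  simp only [h3, mul_one, Finset.sum_const, Finset.card_univ, Fintype.card_fin, nsmul_eq_mul] at h2
  exact (mul_eq_zero.mp h2).resolve_left (by exact_mod_cast (i.pos).ne')

/-! ### Symmetry, smoothness and diagonal derivatives of energy and entropy. -/

theorem energyOf_perm (f g : ℝ → ℝ) (x : Fin d → ℝ) (π : Equiv.Perm (Fin d)) :
    energyOf f g (fun i => x (π i)) = energyOf f g x := by
  rw [energyOf, energyOf, Equiv.sum_comp π (fun i => f (x i))]

theorem contDiffAt_energyOf {f g : ℝ → ℝ} (hf : ContDiffOn ℝ 2 f (Ioi 0)) (hg : ContDiff ℝ 2 g)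
    {σ : ℝ} (hσ : 0 < σ) : ContDiffAt ℝ 2 (energyOf f g) fun _ : Fin d => σ := by
  refine hg.contDiffAt.comp (g := g) _ (ContDiffAt.sum fun i _ => ?_)
  have : ContDiffAt ℝ 2 f σ := hf.contDiffAt (Ioi_mem_nhds hσ)
  exact ContDiffAt.comp (g := f) (fun _ : Fin d => σ) this (contDiffAt_apply ℝ ℝ i _)

theorem ratio_comm (N : ℕ) (a b : ℝ) : ratio N a b = ratio N b a := by
  unfold ratio
  by_cases h : a = b
  · rw [h]
  · rw [if_neg h, if_neg (Ne.symm h), ← neg_sub (b ^ 2), ← neg_sub (b ^ (2 / (N : ℝ))), neg_div_neg_eq]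

/-- The index set `i < j` is not permutation invariant, whereas the full double sum and the diagonal
sum are. The identity also counts the pairs. -/
theorem sum_eq_sum_lt_add_diag {k : Fin d → Fin d → ℝ} (hk : ∀ i j, k i j = k j i) :
    ∑ i, ∑ j, k i j = 2 * ∑ i : Fin d, ∑ j ∈ Finset.univ.filter (fun j => i < j), k i j
      + ∑ i, k i i := by
  have e1 : ∑ i : Fin d, ∑ j ∈ Finset.univ.filter (fun j => i < j), k i j
      = ∑ i : Fin d, ∑ j, if i < j then k i j else 0 := by simp_rw [Finset.sum_filter]
  have e2 : ∑ i : Fin d, ∑ j ∈ Finset.univ.filter (fun j => i < j), k i j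
      = ∑ i : Fin d, ∑ j, if j < i then k i j else 0 := by
    rw [e1, Finset.sum_comm]
    refine Finset.sum_congr rfl fun i _ => Finset.sum_congr rfl fun j _ => ?_
    rw [hk]
  have e3 : ∑ i, k i i = ∑ i : Fin d, ∑ j, if i = j then k i j else 0 := by simp
  rw [two_mul]
  nth_rewrite 1 [e1]
  rw [e2, e3]
  simp_rw [← Finset.sum_add_distrib]
  refine Finset.sum_congr rfl fun i _ => Finset.sum_congr rfl fun j _ => ?_
  rcases lt_trichotomy i j with h | h | h
  · simp [h, h.not_gt, h.ne]
  · simp [h]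
  · simp [h, h.not_gt, h.ne']

theorem entropyOf_perm (N : ℕ) (c : ℝ) (x : Fin d → ℝ) (π : Equiv.Perm (Fin d)) :
    entropyOf N c (fun i => x (π i)) = entropyOf N c x := by
  have h1 := sum_eq_sum_lt_add_diag (k := fun i j => Real.log (ratio N (x i) (x j)))
    fun i j => by rw [ratio_comm]
  have h2 := sum_eq_sum_lt_add_diag (k := fun i j => Real.log (ratio N (x (π i)) (x (π j))))
    fun i j => by rw [ratio_comm]
  have h3 : ∑ i, ∑ j, Real.log (ratio N (x (π i)) (x (π j)))
      = ∑ i, ∑ j, Real.log (ratio N (x i) (x j)) := by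
    rw [← Equiv.sum_comp π (fun i => ∑ j, Real.log (ratio N (x i) (x j)))]
    exact Finset.sum_congr rfl fun i _ =>
      Equiv.sum_comp π (fun j => Real.log (ratio N (x (π i)) (x j)))
  have h4 := Equiv.sum_comp π (fun i => Real.log (ratio N (x i) (x i)))
  unfold entropyOf
  linarith

/-- The quotient is a geometric sum in `a ^ (2/N)` and `b ^ (2/N)`. In this form it is smooth and
positive across `a = b`. -/
theorem ratio_eq_sum {N : ℕ} (hN : 0 < N) {a b : ℝ} (ha : 0 < a) (hb : 0 < b) :
    ratio N a b = ∑ p ∈ Finset.range N,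
      (a ^ (2 / (N : ℝ))) ^ p * (b ^ (2 / (N : ℝ))) ^ (N - 1 - p) := by
  have hNr : (N : ℝ) ≠ 0 := by exact_mod_cast hN.ne'
  unfold ratio
  split_ifs with h
  · subst h
    have : ∀ p ∈ Finset.range N, (a ^ (2 / (N : ℝ))) ^ p * (a ^ (2 / (N : ℝ))) ^ (N - 1 - p)
        = a ^ (2 - 2 / (N : ℝ)) := by
      intro p hp
      have hp' := Finset.mem_range.mp hp
      rw [← pow_add, show p + (N - 1 - p) = N - 1 by omega, ← Real.rpow_mul_natCast ha.le,
        Nat.cast_sub hN]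
      congr 1
      push_cast
      field_simp
    rw [Finset.sum_congr rfl this]
    simp
  · have hpow : ∀ x : ℝ, 0 < x → (x ^ (2 / (N : ℝ))) ^ N = x ^ 2 := by
      intro x hx
      rw [← Real.rpow_mul_natCast hx.le, div_mul_cancel₀ _ hNr]
      norm_cast
    have hne : a ^ (2 / (N : ℝ)) - b ^ (2 / (N : ℝ)) ≠ 0 := by
      rw [sub_ne_zero]
      intro he
      have := congrArg (· ^ N) he
      simp only [hpow a ha, hpow b hb] at this
      exact h ((pow_left_inj₀ ha.le hb.le two_ne_zero).mp this)
    rw [div_eq_iff hne, (Commute.all _ _).geom_sum₂_mul, hpow a ha, hpow b hb]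

theorem contDiffAt_entropyOf {N : ℕ} (hN : 0 < N) (c : ℝ) {σ : ℝ} (hσ : 0 < σ) :
    ContDiffAt ℝ 2 (entropyOf N c) fun _ : Fin d => σ := by
  have hpos : ∀ᶠ l : Fin d → ℝ in 𝓝 (fun _ => σ), ∀ i, 0 < l i := by
    rw [eventually_all]
    intro i
    exact (continuous_apply i).continuousAt.eventually (lt_mem_nhds hσ)
  have key : ContDiffAt ℝ 2 (fun s : Fin d → ℝ => ((N : ℝ) - 1) * c
      + 1 / 2 * ∑ i : Fin d, ∑ j ∈ Finset.univ.filter (fun j => i < j),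
        Real.log (∑ p ∈ Finset.range N,
          (s i ^ (2 / (N : ℝ))) ^ p * (s j ^ (2 / (N : ℝ))) ^ (N - 1 - p))) fun _ => σ := by
    refine contDiffAt_const.add (contDiffAt_const.mul (ContDiffAt.sum fun i _ =>
      ContDiffAt.sum fun j _ => ContDiffAt.log (ContDiffAt.sum fun p _ => ?_) ?_))
    · have h : ∀ i : Fin d, ContDiffAt ℝ 2 (fun s : Fin d → ℝ => s i ^ (2 / (N : ℝ)))
          fun _ => σ := fun i =>
        (contDiffAt_apply ℝ ℝ i _).rpow_const_of_ne hσ.ne'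
      exact ((h i).pow p).mul ((h j).pow _)
    · refine (Finset.sum_pos (fun p _ => by positivity) ⟨0, by simp [hN]⟩).ne'
  refine key.congr_of_eventuallyEq (hpos.mono fun s hs => ?_)
  unfold entropyOf
  simp_rw [fun i j => ratio_eq_sum hN (hs i) (hs j)]

theorem hasDerivAt_entropyOf_diag {N : ℕ} (hN : 0 < N) (c : ℝ) {σ : ℝ} (hσ : 0 < σ) :
    HasDerivAt (fun t : ℝ => entropyOf N c fun _ : Fin d => t)
      (d * (((d : ℝ) - 1) / (2 * σ) * (1 - 1 / (N : ℝ)))) σ := by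
  have hNr : (0 : ℝ) < N := by exact_mod_cast hN
  have hcard : (d : ℝ) * d = 2 * ∑ i : Fin d, ∑ j ∈ Finset.univ.filter (fun j => i < j), (1 : ℝ)
      + d := by
    have := sum_eq_sum_lt_add_diag (d := d) (k := fun _ _ => (1 : ℝ)) fun _ _ => rfl
    simpa only [Finset.sum_const, Finset.card_univ, Fintype.card_fin, nsmul_eq_mul, mul_one]
      using this
  have e : ∀ t : ℝ, entropyOf N c (fun _ : Fin d => t) = ((N : ℝ) - 1) * c
      + ((d : ℝ) * (d - 1) / 4) * Real.log ((N : ℝ) * t ^ (2 - 2 / (N : ℝ))) := by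
    intro t
    unfold entropyOf
    have : ∀ i : Fin d, ∑ j ∈ Finset.univ.filter (fun j => i < j), Real.log (ratio N t t)
        = (∑ j ∈ Finset.univ.filter (fun j => i < j), (1 : ℝ)) * Real.log (ratio N t t) := by
      intro i; simp
    simp_rw [this, ← Finset.sum_mul]
    rw [show ∑ i : Fin d, ∑ j ∈ Finset.univ.filter (fun j => i < j), (1 : ℝ)
      = d * (d - 1) / 2 by linarith, ratio, if_pos rfl]
    ring
  simp_rw [e]
  have h1 : HasDerivAt (fun t : ℝ => (N : ℝ) * t ^ (2 - 2 / (N : ℝ)))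
      (N * ((2 - 2 / (N : ℝ)) * σ ^ (2 - 2 / (N : ℝ) - 1))) σ :=
    (Real.hasDerivAt_rpow_const (Or.inl hσ.ne')).const_mul _
  have hp : 0 < σ ^ (2 - 2 / (N : ℝ)) := Real.rpow_pos_of_pos hσ _
  have h2 := ((h1.log (by positivity)).const_mul ((d : ℝ) * (d - 1) / 4)).const_add
    (((N : ℝ) - 1) * c)
  convert! h2 using 1
  rw [Real.rpow_sub_one hσ.ne']
  field_simp
  ring

theorem hasDerivAt_energyOf_diag {f g : ℝ → ℝ} (hf : ContDiffOn ℝ 2 f (Ioi 0))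
    (hg : ContDiff ℝ 2 g) {σ : ℝ} (hσ : 0 < σ) :
    HasDerivAt (fun t : ℝ => energyOf f g fun _ : Fin d => t)
      (d * (deriv g ((d : ℝ) * f σ) * deriv f σ)) σ := by
  have hf' : HasDerivAt f (deriv f σ) σ :=
    ((hf.contDiffAt (Ioi_mem_nhds hσ)).differentiableAt (by norm_num)).hasDerivAt
  have hg' : HasDerivAt g (deriv g ((d : ℝ) * f σ)) ((d : ℝ) * f σ) :=
    (hg.differentiable (by norm_num)).differentiableAt.hasDerivAt
  have h := HasDerivAt.comp σ hg' (hf'.const_mul (d : ℝ))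
  have e : (fun t : ℝ => energyOf f g fun _ : Fin d => t) = g ∘ fun t => (d : ℝ) * f t := by
    ext t; simp [energyOf]
  rw [e]
  convert! h using 1
  ring

/-! ### The orthogonal orbit, its tangent space and the splitting. -/

theorem hasDerivAt_exp_smul (A : Matrix (Fin d) (Fin d) ℝ) :
    HasDerivAt (fun t : ℝ => NormedSpace.exp (t • A)) A 0 := by
  have h : HasDerivAt (fun t : ℝ => NormedSpace.exp (t • A))
      (NormedSpace.exp ((0 : ℝ) • A) * A) 0 := by
    open scoped Matrix.Norms.Operator in
    exact hasDerivAt_exp_smul_const (𝕂 := ℝ) A 0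
  rwa [zero_smul, NormedSpace.exp_zero, one_mul] at h

theorem exp_mem_orthogonalGroup {A : Matrix (Fin d) (Fin d) ℝ} (hA : Aᵀ = -A) :
    NormedSpace.exp A ∈ orthogonalGroup (Fin d) ℝ := by
  rw [mem_orthogonalGroup_iff, ← exp_transpose, hA, exp_neg, mul_nonsing_inv]
  exact (isUnit_iff_isUnit_det _).mp (isUnit_exp A)

theorem transpose_mul_self_of_mem_orbit {X : Matrix (Fin d) (Fin d) ℝ} {σ : ℝ}
    (h : X ∈ orbit d σ) : Xᵀ * X = σ ^ 2 • (1 : Matrix (Fin d) (Fin d) ℝ) := by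
  obtain ⟨R, hR, rfl⟩ := h
  rw [mem_orthogonalGroup_iff'] at hR
  rw [transpose_smul, smul_mul_smul_comm, hR, sq]

section

attribute [local instance] Matrix.normedAddCommGroup Matrix.normedSpace

theorem transpose_mul_add_of_hasDerivAt {γ : ℝ → Matrix (Fin d) (Fin d) ℝ}
    {C Z : Matrix (Fin d) (Fin d) ℝ} {t : ℝ} (hγ : HasDerivAt γ Z t)
    (hC : ∀ t, (γ t)ᵀ * γ t = C) : (γ t)ᵀ * Z + Zᵀ * γ t = 0 := by
  obtain ⟨L, hL, hLW⟩ := hasFDerivAt_gram (γ t)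
  have h := hL.comp_hasDerivAt t hγ
  rw [← hLW]
  have e : ((fun Y : Matrix (Fin d) (Fin d) ℝ => Yᵀ * Y) ∘ γ) = fun _ => C := funext hC
  rw [e] at h
  exact h.unique (hasDerivAt_const t C)

theorem hasDerivAt_mul_left (X : Matrix (Fin d) (Fin d) ℝ) {γ : ℝ → Matrix (Fin d) (Fin d) ℝ}
    {Z : Matrix (Fin d) (Fin d) ℝ} {t : ℝ} (hγ : HasDerivAt γ Z t) :
    HasDerivAt (fun t => X * γ t) (X * Z) t :=
  (LinearMap.mulLeft ℝ X).toContinuousLinearMap.hasFDerivAt.comp_hasDerivAt t hγ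

end

/-- The Gram matrix is constant along the orbit, which forces `Xᵀ * Z` to be skew; conversely the
curve `X * exp (t • A)` has velocity `X * A`. -/
theorem mem_tangentSpaceAt_orbit_iff {X : Matrix (Fin d) (Fin d) ℝ} {σ : ℝ} (hσ : 0 < σ)
    (hX : X ∈ orbit d σ) (Z : Matrix (Fin d) (Fin d) ℝ) :
    Z ∈ tangentSpaceAt (orbit d σ) X ↔ ∃ A : Matrix (Fin d) (Fin d) ℝ, Aᵀ = -A ∧ Z = X * A := by
  have hXX := transpose_mul_self_of_mem_orbit hX
  have hσ2 : σ ^ 2 ≠ 0 := by positivity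
  have hXX' : X * Xᵀ = σ ^ 2 • (1 : Matrix (Fin d) (Fin d) ℝ) := by
    have h1 : ((σ ^ 2)⁻¹ • Xᵀ) * X = 1 := by
      rw [smul_mul_assoc, hXX, smul_smul, inv_mul_cancel₀ hσ2, one_smul]
    have h2 := mul_eq_one_comm.mp h1
    rw [mul_smul_comm] at h2
    rw [← h2, smul_smul, mul_inv_cancel₀ hσ2, one_smul]
  constructor
  · intro hZ
    induction hZ using Submodule.span_induction with
    | mem Z hZ =>
      obtain ⟨γ, hγ, h0, hd⟩ := hZ
      have h := transpose_mul_add_of_hasDerivAt hd fun t => transpose_mul_self_of_mem_orbit (hγ t)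
      rw [h0] at h
      refine ⟨(σ ^ 2)⁻¹ • (Xᵀ * Z), ?_, ?_⟩
      · rw [transpose_smul, transpose_mul, transpose_transpose, ← smul_neg,
          eq_neg_of_add_eq_zero_right h]
      · rw [mul_smul_comm, ← mul_assoc, hXX', smul_mul_assoc, one_mul, smul_smul,
          inv_mul_cancel₀ hσ2, one_smul]
    | zero => exact ⟨0, by simp, by simp⟩
    | add Z W _ _ hZ hW =>
      obtain ⟨A, hA, rfl⟩ := hZ
      obtain ⟨B, hB, rfl⟩ := hW
      exact ⟨A + B, by rw [transpose_add, hA, hB, neg_add], by rw [mul_add]⟩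
    | smul c Z _ hZ =>
      obtain ⟨A, hA, rfl⟩ := hZ
      exact ⟨c • A, by rw [transpose_smul, hA, smul_neg], by rw [mul_smul_comm]⟩
  · rintro ⟨A, hA, rfl⟩
    refine Submodule.subset_span ⟨fun t => X * NormedSpace.exp (t • A), fun t => ?_, ?_, ?_⟩
    · obtain ⟨R, hR, rfl⟩ := hX
      exact ⟨R * NormedSpace.exp (t • A), mul_mem hR (exp_mem_orthogonalGroup (by
        rw [transpose_smul, hA, smul_neg])), smul_mul_assoc _ _ _⟩
    · simp [NormedSpace.exp_zero]
    · exact hasDerivAt_mul_left X (hasDerivAt_exp_smul A)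

/-- Multiplication by `Qᵀ` reduces this to the decomposition of a matrix into skew, scalar and
traceless symmetric parts. -/
theorem isInternal_orbit_splitting (hd : 0 < d) {Q X : Matrix (Fin d) (Fin d) ℝ} {σ : ℝ}
    (hσ : 0 < σ) (hQ : Q ∈ orthogonalGroup (Fin d) ℝ) (hX : X = σ • Q) :
    DirectSum.IsInternal ![tangentSpaceAt (orbit d σ) X, Submodule.span ℝ {X}, shapeSpace Q] := by
  have hmem := mem_tangentSpaceAt_orbit_iff hσ (X := X) ⟨Q, hQ, hX⟩
  have hQ1 : Qᵀ * Q = 1 := by rwa [mem_orthogonalGroup_iff'] at hQ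
  have hQ2 : Q * Qᵀ = 1 := mul_eq_one_comm.mp hQ1
  have hdr : (d : ℝ) ≠ 0 := by exact_mod_cast hd.ne'
  rw [DirectSum.isInternal_submodule_iff_iSupIndep_and_iSup_eq_top]
  constructor
  · rw [iSupIndep_iff_finsetSum_eq_zero_imp_eq_zero]
    intro s v hv hsum
    set u : Fin 3 → Matrix (Fin d) (Fin d) ℝ := fun i => if i ∈ s then v i else 0 with hu
    have hum : ∀ i, u i ∈ ![tangentSpaceAt (orbit d σ) X, Submodule.span ℝ {X}, shapeSpace Q] i := by
      intro i
      by_cases hi : i ∈ s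
      · simpa only [hu, if_pos hi] using hv i hi
      · simp only [hu, if_neg hi, Submodule.zero_mem]
    have husum : u 0 + u 1 + u 2 = 0 := by
      rw [← Fin.sum_univ_three, hu, Finset.sum_ite_mem, Finset.univ_inter, hsum]
    obtain ⟨A, hA, h0⟩ := (hmem _).mp (hum 0)
    obtain ⟨a, h1⟩ := Submodule.mem_span_singleton.mp (hum 1)
    obtain ⟨S, hS, hS0, h2⟩ := hum 2
    have e1 : σ • A + (a * σ) • (1 : Matrix (Fin d) (Fin d) ℝ) + S = 0 := by
      have : Q * (σ • A + (a * σ) • (1 : Matrix (Fin d) (Fin d) ℝ) + S) = 0 := by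
        rw [← husum, h0, ← h1, h2, hX]
        simp only [mul_add, smul_mul_assoc, mul_smul_comm, mul_one, smul_smul]
      calc _ = Qᵀ * (Q * (σ • A + (a * σ) • (1 : Matrix (Fin d) (Fin d) ℝ) + S)) := by
            rw [← mul_assoc, hQ1, one_mul]
        _ = 0 := by rw [this, mul_zero]
    have e2 := congrArg transpose e1
    rw [transpose_add, transpose_add, transpose_smul, transpose_smul, hA, hS, transpose_one,
      transpose_zero] at e2
    have hA0 : A = 0 := by
      have : (2 * σ) • A = 0 := by
        have e3 : (2 * σ) • A = (σ • A + (a * σ) • (1 : Matrix (Fin d) (Fin d) ℝ) + S)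
            - (σ • -A + (a * σ) • (1 : Matrix (Fin d) (Fin d) ℝ) + S) := by module
        rw [e3, e1, e2, sub_zero]
      exact (smul_eq_zero.mp this).resolve_left (by positivity)
    have ha0 : a = 0 := by
      have := congrArg trace e1
      rw [hA0, smul_zero, zero_add, trace_add, hS0, trace_smul, trace_one, trace_zero] at this
      simp only [smul_eq_mul, Fintype.card_fin, add_zero] at this
      simpa [hσ.ne', hdr] using this
    have hS1 : S = 0 := by
      rw [hA0, ha0, smul_zero, zero_mul, zero_smul, zero_add, zero_add] at e1
      exact e1
    have hu0 : ∀ i, u i = 0 := by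
      intro i
      fin_cases i
      · exact h0.trans (by rw [hA0, mul_zero])
      · exact h1.symm.trans (by rw [ha0, zero_smul])
      · exact h2.trans (by rw [hS1, mul_zero])
    intro i hi
    have := hu0 i
    simpa only [hu, if_pos hi] using this
  · rw [eq_top_iff]
    intro Z _
    have hsup : ∀ i, ![tangentSpaceAt (orbit d σ) X, Submodule.span ℝ {X}, shapeSpace Q] i
        ≤ ⨆ i, ![tangentSpaceAt (orbit d σ) X, Submodule.span ℝ {X}, shapeSpace Q] i :=
      le_iSup _
    set B := Qᵀ * Z with hB
    have hZ : Z = Q * B := by rw [hB, ← mul_assoc, hQ2, one_mul]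
    have h0 : X * ((2 * σ)⁻¹ • (B - Bᵀ)) ∈ tangentSpaceAt (orbit d σ) X :=
      (hmem _).mpr ⟨_, by rw [transpose_smul, transpose_sub, transpose_transpose, ← smul_neg,
        neg_sub], rfl⟩
    have h1 : (trace B / (d * σ)) • X ∈ Submodule.span ℝ {X} :=
      Submodule.smul_mem _ _ (Submodule.mem_span_singleton_self X)
    have h2 : Q * ((2 : ℝ)⁻¹ • (B + Bᵀ) - (trace B / d) • (1 : Matrix (Fin d) (Fin d) ℝ))
        ∈ shapeSpace Q := by
      refine ⟨_, ?_, ?_, rfl⟩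
      · rw [transpose_sub, transpose_smul, transpose_add, transpose_transpose, transpose_smul,
          transpose_one, add_comm]
      · rw [trace_sub, trace_smul, trace_add, trace_transpose, trace_smul, trace_one]
        simp only [smul_eq_mul, Fintype.card_fin]
        field_simp
        ring
    have e : Z = X * ((2 * σ)⁻¹ • (B - Bᵀ)) + (trace B / (d * σ)) • X
        + Q * ((2 : ℝ)⁻¹ • (B + Bᵀ) - (trace B / d) • (1 : Matrix (Fin d) (Fin d) ℝ)) := by
      rw [hX, smul_mul_assoc, mul_smul_comm, smul_smul, smul_smul, mul_sub Q (_ • _),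
        mul_smul_comm, mul_smul_comm, mul_one, mul_sub, mul_add, ← hZ]
      have e1 : σ * (2 * σ)⁻¹ = 2⁻¹ := by field_simp
      have e2 : trace B / (d * σ) * σ = trace B / d := by field_simp
      rw [e1, e2]
      module
    rw [e]
    exact add_mem (add_mem (hsup 0 h0) (hsup 1 h1)) (hsup 2 h2)

/-! ### Assembling the linearization. -/

theorem eventually_isUnit {X : Matrix (Fin d) (Fin d) ℝ} (hX : IsUnit X) :
    ∀ᶠ Y in 𝓝 X, IsUnit Y := by
  have h : ContinuousAt (fun Y : Matrix (Fin d) (Fin d) ℝ => Y.det) X :=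
    (continuous_id.matrix_det).continuousAt
  rw [isUnit_iff_isUnit_det, isUnit_iff_ne_zero] at hX
  filter_upwards [h.eventually_ne hX] with Y hY
  rw [isUnit_iff_isUnit_det, isUnit_iff_ne_zero]
  exact hY

/-- Squared singular values are the eigenvalues of `Yᵀ * Y`; positivity on invertible matrices
allows the square roots to be taken back. -/
theorem freeEnergy_eq {N : ℕ} {c β : ℝ} {E : Matrix (Fin d) (Fin d) ℝ → ℝ} {f g : ℝ → ℝ}
    (hE : IsSpectralEnergy E f g) {Y : Matrix (Fin d) (Fin d) ℝ} (hY : IsUnit Y) :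
    freeEnergy N c β E Y = energyOf f g (fun i => √(sv Y i ^ 2))
      - β⁻¹ * entropyOf N c (fun i => √(sv Y i ^ 2)) := by
  have : (fun i => √(sv Y i ^ 2)) = sv Y := funext fun i => Real.sqrt_sq (sv_pos hY i).le
  rw [this, freeEnergy, hE.eq Y hY, entropy, energyOf]

end DLN

open DLN

theorem corollary1p5 (N d : ℕ) (hN : 0 < N) (hd : 0 < d) (β : ℝ) (hβ : 0 < β) (c : ℝ)
    (E : Matrix (Fin d) (Fin d) ℝ → ℝ) (f g : ℝ → ℝ) (hE : DLN.IsSpectralEnergy E f g)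
    (hf : ContDiffOn ℝ 2 f (Set.Ioi 0)) (hg : ContDiff ℝ 2 g)
    (σ : ℝ) (hσ : 0 < σ)
    (hbal : deriv g ((d : ℝ) * f σ) * deriv f σ
      = β⁻¹ * (((d : ℝ) - 1) / (2 * σ)) * (1 - 1 / (N : ℝ)))
    (Q X : Matrix (Fin d) (Fin d) ℝ) (hQ : Q ∈ Matrix.orthogonalGroup (Fin d) ℝ)
    (hX : X = σ • Q) :
    -- the eigenvalues of the Euclidean Hessians of `E(σ)` and `S_N(σ)` at `(σ, …, σ)`
    ∃ θ₁E θpE θ₁S θpS : ℝ,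
      DLN.HasEigs (DLN.hess (DLN.energyOf f g) (fun _ : Fin d => σ)) θ₁E θpE ∧
      DLN.HasEigs (DLN.hess (DLN.entropyOf N c) (fun _ : Fin d => σ)) θ₁S θpS ∧
      -- the gradient is well defined near `X`, and `X` is an equilibrium of the flow
      (∀ᶠ Y in nhds X, DLN.IsGradAt N (DLN.freeEnergy N c β E) Y
        (DLN.grad N (DLN.freeEnergy N c β E) Y)) ∧
      DLN.grad N (DLN.freeEnergy N c β E) X = 0 ∧
      -- the splitting
      (∀ Z, Z ∈ DLN.tangentSpaceAt (DLN.orbit d σ) X ↔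
        ∃ A : Matrix (Fin d) (Fin d) ℝ, A.transpose = -A ∧ Z = X * A) ∧
      DirectSum.IsInternal ![DLN.tangentSpaceAt (DLN.orbit d σ) X,
        Submodule.span ℝ {X}, DLN.shapeSpace Q] ∧
      -- the linearization of the flow at `X` is diagonal in the splitting
      ∃ L : Matrix (Fin d) (Fin d) ℝ →L[ℝ] Matrix (Fin d) (Fin d) ℝ,
        HasFDerivAt (fun Y => -DLN.grad N (DLN.freeEnergy N c β E) Y) L X ∧
        (∀ Z ∈ DLN.tangentSpaceAt (DLN.orbit d σ) X, L Z = 0) ∧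
        (∀ Z ∈ Submodule.span ℝ {X}, L Z = DLN.rate N β σ θ₁E θ₁S • Z) ∧
        (∀ Z ∈ DLN.shapeSpace Q, L Z = DLN.rate N β σ θpE θpS • Z) := by
  have hXo : X ∈ orbit d σ := ⟨Q, hQ, hX⟩
  have hXX := transpose_mul_self_of_mem_orbit hXo
  have hQ1 : Qᵀ * Q = 1 := by rwa [mem_orthogonalGroup_iff'] at hQ
  have hXu : IsUnit X := by
    refine IsUnit.of_mul_eq_one_right ((σ ^ 2)⁻¹ • Xᵀ) ?_
    rw [smul_mul_assoc, hXX, smul_smul, inv_mul_cancel₀ (by positivity), one_smul]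
  obtain ⟨φ, hφ⟩ : ∃ φ : (Fin d → ℝ) → ℝ,
    φ = fun t => energyOf f g t - β⁻¹ * entropyOf N c t := ⟨_, rfl⟩
  have hEC := contDiffAt_energyOf (d := d) hf hg hσ
  have hSC := contDiffAt_entropyOf (d := d) hN c hσ
  have hφC : ContDiffAt ℝ 2 φ fun _ => σ := by
    rw [hφ]; exact hEC.sub (contDiffAt_const.mul hSC)
  have hφs : ∀ x, ∀ π : Equiv.Perm (Fin d), φ (fun i => x (π i)) = φ x := by
    intro x π
    rw [hφ]
    simp only [energyOf_perm, entropyOf_perm]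
  obtain ⟨aE, bE, hHE⟩ := exists_hess_eq (φ := energyOf (d := d) f g) (energyOf_perm f g) σ
  obtain ⟨aS, bS, hHS⟩ := exists_hess_eq (φ := entropyOf (d := d) N c) (entropyOf_perm N c) σ
  have hH : ∀ i j, hess φ (fun _ => σ) i j
      = (aE - β⁻¹ * aS) * (if i = j then 1 else 0) + (bE - β⁻¹ * bS) := by
    intro i j
    rw [hφ, hess_sub_const_mul hEC hSC, hHE, hHS]
    ring
  have hφ0 : ∀ i, partials φ (fun _ => σ) i = 0 := by
    refine partials_eq_zero hφs (hφC.differentiableAt (by norm_num)) ?_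
    rw [hφ]
    -- The balance equation says exactly that `φ` is stationary along the diagonal.
    have h := (hasDerivAt_energyOf_diag (d := d) hf hg hσ).sub
      ((hasDerivAt_entropyOf_diag (d := d) hN c hσ).const_mul β⁻¹)
    convert! h using 1
    rw [hbal]
    ring
  obtain ⟨v', hv', hv'x⟩ := hasFDerivAt_rescaled_partials hσ hφC hφ0 hH (N : ℝ) (2 - 2 / (N : ℝ))
  obtain ⟨ψ, hψ⟩ : ∃ ψ : (Fin d → ℝ) → ℝ, ψ = fun m => φ fun k => √(m k) := ⟨_, rfl⟩
  rw [← hψ] at hv'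
  have hψC : ContDiffAt ℝ 2 ψ fun _ => σ ^ 2 := hψ ▸ contDiffAt_comp_sqrt hσ hφC
  have hψs : ∀ x, ∀ π : Equiv.Perm (Fin d), ψ (fun i => x (π i)) = ψ x := by
    intro x π
    rw [hψ]
    exact hφs (fun i => √(x i)) π
  have hψ0 : ∀ i, partials ψ (fun _ => σ ^ 2) i = 0 := by
    have hs : (fun _ : Fin d => √(σ ^ 2)) = fun _ => σ := by rw [Real.sqrt_sq hσ.le]
    obtain ⟨D, hD, -⟩ := hasFDerivAt_sqrt_comp (d := d) (l := fun _ => σ ^ 2)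
      (fun _ => by positivity)
    have hφd : HasFDerivAt φ (0 : (Fin d → ℝ) →L[ℝ] ℝ) (fun _ : Fin d => √(σ ^ 2)) := by
      rw [hs]
      refine (hφC.differentiableAt (by norm_num)).hasFDerivAt.congr_fderiv ?_
      ext1 x
      rw [fderiv_apply_eq_sum]
      simp [hφ0]
    have := hφd.comp _ hD
    intro i
    rw [partials, hψ, HasFDerivAt.fderiv (f := fun m : Fin d → ℝ => φ fun k => √(m k)) this]
    simp
  choose U hU using fun Y : Matrix (Fin d) (Fin d) ℝ => exists_isDiag_sv Y
  obtain ⟨v, hv⟩ : ∃ v : (Fin d → ℝ) → Fin d → ℝ, v = fun l i => (N : ℝ) * √(l i) ^ (2 - 2 / (N : ℝ))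
    * (2 * partials ψ l i) := ⟨_, rfl⟩
  rw [← hv] at hv'
  have hgrad : ∀ᶠ Y in 𝓝 X, IsGradAt N (freeEnergy N c β E) Y (grad N (freeEnergy N c β E) Y) ∧
      grad N (freeEnergy N c β E) Y
        = Y * (U Y * diagonal (v fun i => sv Y i ^ 2) * (U Y)ᵀ) := by
    filter_upwards [eventually_hasFDerivAt_spectral hψs hψC hXX,
      (eventually_isUnit hXu).eventually_nhds] with Y hY hYu
    obtain ⟨F', hF', hF'W⟩ := hY (U Y) (hU Y)
    have hF : HasFDerivAt (freeEnergy N c β E) F' Y := by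
      refine hF'.congr_of_eventuallyEq (hYu.mono fun Z hZ => ?_)
      rw [freeEnergy_eq hE hZ, hψ, hφ]
    have hpos := sv_pos hYu.self_of_nhds
    have h := isGradAt_grad (isUnit_opA hN hpos (hU Y)) hF.differentiableAt
      (fun W => by rw [hF.fderiv, hF'W])
    refine ⟨h.1, h.2.trans ?_⟩
    rw [opA_mul_conj hN hpos (hU Y), hv]
    simp only [Real.sqrt_sq (hpos _).le]
  have hv0 : v (fun _ => σ ^ 2) = 0 := by
    rw [hv]; ext i; simp [hψ0]
  obtain ⟨L, hL, hLW⟩ := hasFDerivAt_mul_conj hv' hv0 hv'x hXX hU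
  have hsX : (fun i => sv X i ^ 2) = fun _ : Fin d => σ ^ 2 := sv_sq_eq hXX
  have hLgrad : HasFDerivAt (fun Y => -grad N (freeEnergy N c β E) Y) (-L) X :=
    hasFDerivAt_matrix_neg (hL.congr_of_eventuallyEq (hgrad.mono fun Y hY => hY.2))
  have hmem := mem_tangentSpaceAt_orbit_iff hσ hXo
  refine ⟨_, _, _, _, hasEigs_of_eq hHE, hasEigs_of_eq hHS, hgrad.mono fun Y hY => hY.1, ?_,
    hmem, isInternal_orbit_splitting hd hσ hQ hX, -L, hLgrad, fun Z hZ => ?_, fun Z hZ => ?_,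
    fun Z hZ => ?_⟩
  · rw [hgrad.self_of_nhds.2, hsX, hv0, diagonal_zero', mul_zero, zero_mul, mul_zero]
  · obtain ⟨A, hA, rfl⟩ := (hmem Z).mp hZ
    have e : Xᵀ * (X * A) + (X * A)ᵀ * X = 0 := by
      rw [← mul_assoc, transpose_mul, mul_assoc Aᵀ, hXX, hA, smul_mul_assoc, mul_smul_comm,
        one_mul, mul_one, smul_neg, add_neg_cancel]
    change -L (X * A) = 0
    rw [hLW, e]
    simp
  -- For the direction `X` the Gram matrix varies by `2σ² • 1`, of trace `2σ² d`; this yields the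
  -- combination `a + b d` of the Hessian coefficients.
  · obtain ⟨a, rfl⟩ := Submodule.mem_span_singleton.mp hZ
    change -L (a • X) = _
    rw [map_smul, hLW, hXX, trace_add, trace_smul, trace_one, mul_add, mul_smul_comm, mul_one,
      rate]
    simp only [smul_smul, ← add_smul, ← neg_smul, smul_eq_mul, Fintype.card_fin]
    congr 1
    field_simp
    ring
  -- Here the variation `2σ • S` is traceless, so only the coefficient `a` contributes.
  · obtain ⟨S, hS, hS0, rfl⟩ := hZ
    have e : Xᵀ * (Q * S) + (Q * S)ᵀ * X = (2 * σ) • S := by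
      rw [hX, transpose_smul, smul_mul_assoc, ← mul_assoc, hQ1, one_mul, mul_smul_comm,
        transpose_mul, mul_assoc, hQ1, mul_one, hS, ← add_smul, two_mul]
    change -L (Q * S) = _
    rw [hLW, e, trace_smul, hS0, smul_zero, mul_zero, zero_smul, add_zero, hX, mul_smul_comm,
      smul_mul_assoc, smul_smul, smul_smul, rate, ← neg_smul]
    congr 1
    field_simp
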